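/- Let $a\ge 2$ be an integer and $\omega_a=e^{2\pi i/a}$. Let $\varphi_0$ be the $1$-periodic function on $\mathbb R$ with $\varphi_0(x)=\omega_a^{k}$ for $x\in[\frac ka,\frac{k+1}a)$, $k=0,\dots,a-1$, and put $\varphi_j(x)=\varphi_0(a^jx)$. The generalized Walsh system of order $a$ is $\psi_n=\prod_j\varphi_j^{\alpha_j}$ for $n=\sum_j\alpha_ja^j$ with digits $0\le\alpha_j<a$. Let $T=[0,1]^2$. For a measurable weight $\mu$ with $0<\mu\le1$ on $T$, let $L^1_\mu(T)$ be the space of (complex-valued) measurable functions $f$ on $T$ with $\|f\|_{\mu}=\iint_T|f(x,y)|\,\mu(x,y)\,dx\,dy<\infty$. Theorem. There exist complex numbers $c_{n,k}$, $n,k\ge1$, with $\sum_{n,k=1}^\infty|c_{n,k}|^q<\infty$ for all $q>2$, such that for every $\varepsilon>0$ there is a measurable function $\mu$ on $T$ with $$0<\mu(x,y)\le 1,\qquad \bigl|\{(x,y)\in T:\mu(x,y)\ne1\}\bigr|<\varepsilon,$$ for which the double series $\sum_{n,k=1}^\infty c_{n,k}\psi_n(x)\psi_k(y)$ is universal in $L^1_\mu(T)$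 with respect to rearrangements, for convergence in the sense of both rectangular and spherical partial sums. That is, write $F_{(n,k)}(x,y)=c_{n,k}\psi_n(x)\psi_k(y)$; then for every $f\in L^1_\mu(T)$ there is a bijection $\sigma$ of $\{1,2,\dots\}^2$ onto itself such that $$\lim_{n,m\to\infty}\Bigl\|\sum_{k=1}^{n}\sum_{\nu=1}^{m}F_{\sigma(k,\nu)}-f\Bigr\|_\mu=0 \qquad\text{and}\qquad \lim_{R\to\infty}\Bigl\|\sum_{k,\nu\ge1,\ k^2+\nu^2\le R^2}F_{\sigma(k,\nu)}-f\Bigr\|_\mu=0,$$ where $n,m$ tend to infinity independently. -/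

import Mathlib

open MeasureTheory Filter Topology
open scoped ENNReal

noncomputable section

namespace WalshUniversal

/-- The primitive root of unity `ω_a = exp (2πi / a)`. -/
def omega (a : ℕ) : ℂ := Complex.exp (2 * Real.pi * Complex.I / a)

/-- The Rademacher system of order `a`: `φ_0` has period `1` and equals `ω_a ^ k` on
`[k/a, (k+1)/a)` for `k < a`, and `φ_n(x) = φ_0(a ^ n * x)`. -/
def rademacher (a n : ℕ) (x : ℝ) : ℂ :=
  omega a ^ ⌊(a : ℝ) * Int.fract ((a : ℝ) ^ n * x)⌋₊

/-- The generalized Walsh system of order `a`: `ψ_n = ∏_j φ_j ^ α_j`, where `α_j` is the `j`-th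
digit of `n` in base `a`; in particular `ψ_0 = 1`. -/
def walsh (a n : ℕ) (x : ℝ) : ℂ :=
  ∏ j ∈ Finset.range (Nat.digits a n).length, rademacher a j x ^ (Nat.digits a n).getD j 0

/-- The unit square `T = [0,1]²`. -/
def unitSquare : Set (ℝ × ℝ) := Set.Icc 0 1 ×ˢ Set.Icc 0 1

/-- A weight on the unit square: measurable with values in `(0, 1]`. -/
structure IsWeight (μ : ℝ × ℝ → ℝ) : Prop where
  measurable : Measurable μ
  pos : ∀ p ∈ unitSquare, 0 < μ p
  le_one : ∀ p ∈ unitSquare, μ p ≤ 1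

/-- The weighted norm `∫∫_T |g(x,y)| μ(x,y) dx dy`, with values in `[0, ∞]`. -/
def weightedNorm (μ : ℝ × ℝ → ℝ) (g : ℝ × ℝ → ℂ) : ℝ≥0∞ :=
  ∫⁻ p in unitSquare, ‖g p‖ₑ * ENNReal.ofReal (μ p)

/-- Membership in the weighted space `L¹_μ(T)`. -/
def MemWeightedL1 (μ : ℝ × ℝ → ℝ) (f : ℝ × ℝ → ℂ) : Prop :=
  AEStronglyMeasurable f (volume.restrict unitSquare) ∧ weightedNorm μ f < ⊤

/-- The indices `(k, ν)` with `1 ≤ k ≤ n` and `1 ≤ ν ≤ m`, where `N = (n, m)`. -/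
def rectIndex (N : ℕ+ × ℕ+) : Finset (ℕ+ × ℕ+) := Finset.Icc 1 N.1 ×ˢ Finset.Icc 1 N.2

open Classical in
/-- The indices `(k, ν)` with `k, ν ≥ 1` and `k² + ν² ≤ R²`. -/
def diskIndex (R : ℝ) : Finset (ℕ+ × ℕ+) :=
  (rectIndex (⌈|R|⌉₊.succPNat, ⌈|R|⌉₊.succPNat)).filter
    fun p => ((p.1 : ℕ) : ℝ) ^ 2 + ((p.2 : ℕ) : ℝ) ^ 2 ≤ R ^ 2

/-- The bounding box in the definition of `diskIndex` removes nothing. -/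
theorem mem_diskIndex (R : ℝ) (p : ℕ+ × ℕ+) :
    p ∈ diskIndex R ↔ ((p.1 : ℕ) : ℝ) ^ 2 + ((p.2 : ℕ) : ℝ) ^ 2 ≤ R ^ 2 := by
  have key : ∀ k : ℕ+, ((k : ℕ) : ℝ) ^ 2 ≤ R ^ 2 → k ≤ ⌈|R|⌉₊.succPNat := by
    intro k hk
    have h1 : ((k : ℕ) : ℝ) ≤ |R| := by
      have := sq_le_sq.mp hk
      rwa [abs_of_nonneg (Nat.cast_nonneg _)] at this
    have h2 : (k : ℕ) ≤ ⌈|R|⌉₊ := by exact_mod_cast h1.trans (Nat.le_ceil _)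
    rw [← PNat.coe_le_coe, Nat.succPNat_coe]
    exact h2.trans (Nat.le_succ _)
  unfold diskIndex rectIndex
  simp only [Finset.mem_filter, Finset.mem_product, Finset.mem_Icc, one_le, true_and,
    and_iff_right_iff_imp]
  intro h
  exact ⟨key _ (by nlinarith [sq_nonneg ((p.2 : ℕ) : ℝ)]),
    key _ (by nlinarith [sq_nonneg ((p.1 : ℕ) : ℝ)])⟩

/-- `φ_0` takes the value `ω_a ^ k` on `[k/a, (k+1)/a)`. -/
theorem rademacher_zero {a k : ℕ} (hk : k < a) {x : ℝ}
    (hx : x ∈ Set.Ico ((k : ℝ) / a) (((k : ℝ) + 1) / a)) : rademacher a 0 x = omega a ^ k := by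
  have ha : (0 : ℝ) < a := by exact_mod_cast (Nat.zero_le k).trans_lt hk
  have h1 : (k : ℝ) ≤ a * x := by have := (div_le_iff₀ ha).mp hx.1; linarith
  have h2 : a * x < (k : ℝ) + 1 := by have := (lt_div_iff₀ ha).mp hx.2; linarith
  have hka : (k : ℝ) + 1 ≤ a := by exact_mod_cast hk
  have h0 : 0 ≤ x := le_trans (by positivity) hx.1
  have hx1 : x < 1 := by nlinarith
  have hf : Int.fract x = x := Int.fract_eq_self.mpr ⟨h0, hx1⟩
  have hfl : ⌊(a : ℝ) * x⌋₊ = k := (Nat.floor_eq_iff (by positivity)).mpr ⟨h1, h2⟩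
  simp [rademacher, hf, hfl]

/-- The terms `c_{n,k} ψ_n(x) ψ_k(y)`, `n, k ≥ 1`, of a double series by the generalized Walsh
system of order `a`. -/
def walshTerm (a : ℕ) (c : ℕ+ × ℕ+ → ℂ) (i : ℕ+ × ℕ+) (p : ℝ × ℝ) : ℂ :=
  c i * walsh a i.1 p.1 * walsh a i.2 p.2

/-- The double series `∑ F (n,k)` is universal in `L¹_μ(T)` with respect to rearrangements: for
every `f` in the space, its terms can be permuted so that the rearranged double series converges
to `f` in the norm of the space, both by rectangular partial sums (both side lengths tending to
infinity independently) and by spherical partial sums. -/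
def IsUniversalRearrangement (μ : ℝ × ℝ → ℝ) (F : ℕ+ × ℕ+ → ℝ × ℝ → ℂ) : Prop :=
  ∀ f : ℝ × ℝ → ℂ, MemWeightedL1 μ f → ∃ σ : Equiv.Perm (ℕ+ × ℕ+),
    Tendsto (fun N : ℕ+ × ℕ+ => weightedNorm μ fun p => (∑ i ∈ rectIndex N, F (σ i) p) - f p)
      atTop (𝓝 0) ∧
    Tendsto (fun R : ℝ => weightedNorm μ fun p => (∑ i ∈ diskIndex R, F (σ i) p) - f p)
      atTop (𝓝 0)

end WalshUniversal

end

/-!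
The series is built from blocks, one for each member of a sequence `g m` of continuous functions
that is dense in `C(T)` and visits every neighbourhood infinitely often; the spectra of the blocks
are disjoint and all other coefficients are zero.

**One block** (`exists_walsh_polynomial`). Approximate `g` by a step function on the `a`-adic
cells of a fine level `l`. On the cell `I × J` number `t`, with value `γ`, use
`γ 1_I(x) 1_J(y) R(a ^ s x) R(a ^ s y)`, where `R = a ^ r 1_[0, a ^ (-r)) - 1` has mean zero. This
equals `γ 1_(I × J)` off a set of proportion at most `2 a ^ (-r)` in the cell. Since the Dirichlet kernel
`∑_{n < a ^ l} ψ_n(x) conj (ψ_n(t))` is `a ^ l` times the indicator of the cell of `t`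
(`sum_walsh_kernel`), it is a Walsh polynomial with frequencies `n + a ^ s m`, `n < a ^ l`,
`1 ≤ m < a ^ r`, whose coefficients all have modulus `|γ| a ^ (-2l)`; different `s = s_t` make the
spectra of the cells disjoint. When `l → ∞` with `r` fixed, the sum of the squares of all
coefficients stays bounded while their maximum tends to zero, so the sum of the powers of exponent
`2 + ε` is small. Listed cell by cell, every partial sum consists of complete cells, where it is
pointwise dominated by the step function off the exceptional set, and a part of one cell, whose
`L²` norm is at most `|γ| a ^ (r - l)` by orthonormality (`integral_walshTerm_mul_conj`).

**The weight** (`exists_weight`). The exceptional sets have summable measures, so a weight equal to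
one off the later ones and sufficiently small on each of them makes what happens there negligible.
Hence in the weighted norm the block `m` is close to `g m`, and its partial sums are bounded by the
norm of `g m` up to a null sequence.

**The rearrangement** (`exists_enumeration_tendsto`). Given `f`, alternately append the first unused
term, whose norm tends to zero, and an untouched block for a `g m` close to the remaining error.
All indices with `n ≠ 1` are enumerated in this way and the resulting sequence is placed in the row
`ν = 1` of the double array. The other rows are filled with the indices `(1, k)`, whose
coefficients are zero, so that rectangular and spherical partial sums are both partial sums of
the simple series.
-/

namespace WalshUniversal

open ComplexConjugate

/-! ### The root of unity and the Rademacher functions -/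

theorem omega_isPrimitiveRoot {a : ℕ} (ha : 2 ≤ a) : IsPrimitiveRoot (omega a) a :=
  Complex.isPrimitiveRoot_exp a (by omega)

theorem omega_ne_zero (a : ℕ) : omega a ≠ 0 := Complex.exp_ne_zero _

theorem norm_omega {a : ℕ} (ha : 2 ≤ a) : ‖omega a‖ = 1 :=
  (omega_isPrimitiveRoot ha).norm'_eq_one (by omega)

/-- The floor of a scaled fractional part may be replaced by an integral power, without the
reduction modulo one: the two exponents differ by a multiple of `a`. -/
theorem rademacher_eq_zpow {a : ℕ} (ha : 2 ≤ a) (n : ℕ) (x : ℝ) :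
    rademacher a n x = omega a ^ (⌊(a : ℝ) ^ (n + 1) * x⌋ : ℤ) := by
  have h1 : (a : ℝ) ^ (n + 1) * x
      = (a : ℝ) * Int.fract ((a : ℝ) ^ n * x) + ((a * ⌊(a : ℝ) ^ n * x⌋ : ℤ) : ℝ) := by
    push_cast
    rw [← mul_add, add_comm (Int.fract _), Int.floor_add_fract]
    ring
  have h2 : 0 ≤ (a : ℝ) * Int.fract ((a : ℝ) ^ n * x) :=
    mul_nonneg (Nat.cast_nonneg _) (Int.fract_nonneg _)
  rw [h1, Int.floor_add_intCast, zpow_add₀ (omega_ne_zero a), zpow_mul, zpow_natCast,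
    (omega_isPrimitiveRoot ha).pow_eq_one, one_zpow, mul_one, rademacher,
    ← Int.natCast_floor_eq_floor h2, zpow_natCast]

theorem norm_rademacher {a : ℕ} (ha : 2 ≤ a) (n : ℕ) (x : ℝ) : ‖rademacher a n x‖ = 1 := by
  simp [rademacher, norm_omega ha]

theorem rademacher_mul_conj {a : ℕ} (ha : 2 ≤ a) (n : ℕ) (x : ℝ) :
    rademacher a n x * conj (rademacher a n x) = 1 := by
  rw [Complex.mul_conj, Complex.normSq_eq_norm_sq, norm_rademacher ha]
  simp

theorem rademacher_succ (a n : ℕ) (x : ℝ) :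
    rademacher a (n + 1) x = rademacher a n (a * x) := by
  simp only [rademacher, pow_succ, mul_assoc]

theorem rademacher_add_one (a n : ℕ) (x : ℝ) :
    rademacher a n (x + 1) = rademacher a n x := by
  have h : (a : ℝ) ^ n * (x + 1) = (a : ℝ) ^ n * x + ((a ^ n : ℕ) : ℝ) := by push_cast; ring
  rw [rademacher, h, Int.fract_add_natCast, rademacher]

theorem rademacher_zero_shift {a : ℕ} (ha : 2 ≤ a) (x : ℝ) :
    rademacher a 0 (x + 1 / a) = omega a * rademacher a 0 x := by
  have ha0 : (a : ℝ) ≠ 0 := by positivity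
  have h : (a : ℝ) ^ (0 + 1) * (x + 1 / a) = (a : ℝ) ^ (0 + 1) * x + 1 := by
    rw [zero_add, pow_one, mul_add, mul_one_div_cancel ha0]
  rw [rademacher_eq_zpow ha, rademacher_eq_zpow ha, h, Int.floor_add_one,
    zpow_add₀ (omega_ne_zero a), zpow_one, mul_comm]

@[fun_prop]
theorem measurable_rademacher (a n : ℕ) : Measurable (rademacher a n) := by
  unfold rademacher
  have h : Measurable fun x : ℝ => ⌊(a : ℝ) * Int.fract ((a : ℝ) ^ n * x)⌋₊ :=
    Nat.measurable_floor.comp (measurable_const.mul (measurable_fract.comp (by fun_prop)))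
  exact (measurable_from_top (f := fun k : ℕ => omega a ^ k)).comp h

/-! ### The Walsh functions -/

@[simp] theorem walsh_zero (a : ℕ) (x : ℝ) : walsh a 0 x = 1 := by simp [walsh]

/-- Splitting off the lowest digit of the index. -/
theorem walsh_digit {a : ℕ} (ha : 2 ≤ a) {d : ℕ} (hd : d < a) (n : ℕ) (x : ℝ) :
    walsh a (d + a * n) x = rademacher a 0 x ^ d * walsh a n (a * x) := by
  by_cases h : d ≠ 0 ∨ n ≠ 0
  · rw [walsh, Nat.digits_add a (by omega) d n hd h, List.length_cons, Finset.prod_range_succ']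
    simp only [List.getD_cons_succ, List.getD_cons_zero, rademacher_succ]
    rw [mul_comm, walsh]
  · push Not at h
    simp [h.1, h.2]

theorem walsh_add_mul_pow {a : ℕ} (ha : 2 ≤ a) (s : ℕ) :
    ∀ {n : ℕ} (_ : n < a ^ s) (m : ℕ) (x : ℝ),
      walsh a (n + a ^ s * m) x = walsh a n x * walsh a m ((a : ℝ) ^ s * x) := by
  induction s with
  | zero =>
    intro n hn m x
    have : n = 0 := by simpa using hn
    simp [this]
  | succ s ih =>
    intro n hn m x
    have h1 : n / a < a ^ s := Nat.div_lt_of_lt_mul (by rwa [pow_succ, mul_comm] at hn)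
    have h2 : n % a < a := Nat.mod_lt _ (by omega)
    have h3 : n + a ^ (s + 1) * m = n % a + a * (n / a + a ^ s * m) := by
      conv_lhs => rw [← Nat.mod_add_div n a]
      ring
    rw [h3, walsh_digit ha h2, ih h1]
    conv_rhs => rw [← Nat.mod_add_div n a, walsh_digit ha h2]
    rw [pow_succ, mul_assoc ((a : ℝ) ^ s), mul_assoc]

theorem norm_walsh {a : ℕ} (ha : 2 ≤ a) (n : ℕ) (x : ℝ) : ‖walsh a n x‖ = 1 := by
  simp [walsh, norm_prod, norm_rademacher ha]

theorem walsh_at_zero (a n : ℕ) : walsh a n 0 = 1 := by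
  simp [walsh, rademacher]

theorem walsh_periodic (a n : ℕ) : Function.Periodic (walsh a n) 1 := by
  intro x
  simp [walsh, rademacher_add_one]

@[fun_prop]
theorem measurable_walsh (a n : ℕ) : Measurable (walsh a n) := by
  unfold walsh
  fun_prop

/-! ### Cells and the Dirichlet kernel -/

/-- The index `i < a ^ l` of the `a`-adic cell `[i / a ^ l, (i + 1) / a ^ l)` that contains `x`
modulo one. -/
noncomputable def cell (a l : ℕ) (x : ℝ) : ℕ := ⌊(a : ℝ) ^ l * Int.fract x⌋₊

theorem cell_lt {a : ℕ} (ha : 2 ≤ a) (l : ℕ) (x : ℝ) : cell a l x < a ^ l := by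
  have h : (0 : ℝ) < (a : ℝ) ^ l := by positivity
  rw [cell, Nat.floor_lt (mul_nonneg h.le (Int.fract_nonneg x))]
  push_cast
  nlinarith [Int.fract_lt_one x]

theorem cell_natCast_div {a : ℕ} (ha : 2 ≤ a) {l i : ℕ} (hi : i < a ^ l) :
    cell a l ((i : ℝ) / (a : ℝ) ^ l) = i := by
  have h : (0 : ℝ) < (a : ℝ) ^ l := by positivity
  have h1 : (i : ℝ) < (a : ℝ) ^ l := by exact_mod_cast hi
  rw [cell, Int.fract_eq_self.mpr ⟨by positivity, (div_lt_one h).mpr h1⟩,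
    mul_div_cancel₀ _ h.ne', Nat.floor_natCast]

@[fun_prop]
theorem measurable_cell (a l : ℕ) : Measurable (cell a l) :=
  Nat.measurable_floor.comp (measurable_const.mul measurable_fract)

theorem cell_at_zero (a l : ℕ) : cell a l 0 = 0 := by simp [cell]

theorem cell_level_zero (a : ℕ) (x : ℝ) : cell a 0 x = 0 := by
  simp [cell, Int.fract_lt_one]

theorem cell_succ {a : ℕ} (ha : 2 ≤ a) (l : ℕ) (x : ℝ) :
    cell a (l + 1) x = cell a l (a * x) + a ^ l * cell a 1 x := by
  have h0 : (0 : ℝ) ≤ (a : ℝ) * Int.fract x :=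
    mul_nonneg (Nat.cast_nonneg _) (Int.fract_nonneg _)
  have h1 : Int.fract ((a : ℝ) * x) = Int.fract ((a : ℝ) * Int.fract x) := by
    have : (a : ℝ) * x = (a : ℝ) * Int.fract x + ((a * ⌊x⌋ : ℤ) : ℝ) := by
      push_cast
      rw [← mul_add, add_comm (Int.fract _), Int.floor_add_fract]
    rw [this, Int.fract_add_intCast]
  have h2 : (a : ℝ) * Int.fract x
      = Int.fract ((a : ℝ) * Int.fract x) + (⌊(a : ℝ) * Int.fract x⌋₊ : ℝ) := by
    conv_lhs => rw [← Int.floor_add_fract ((a : ℝ) * Int.fract x)]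
    rw [add_comm, ← natCast_floor_eq_intCast_floor h0]
  have h3 : (a : ℝ) ^ (l + 1) * Int.fract x
      = (a : ℝ) ^ l * Int.fract ((a : ℝ) * Int.fract x)
        + ((a ^ l * ⌊(a : ℝ) * Int.fract x⌋₊ : ℕ) : ℝ) := by
    push_cast
    rw [← mul_add, ← h2]
    ring
  rw [cell, h3, Nat.floor_add_natCast (mul_nonneg (by positivity) (Int.fract_nonneg _)), cell,
    cell, pow_one, h1]

theorem cell_succ_eq_iff {a : ℕ} (ha : 2 ≤ a) (l : ℕ) (x t : ℝ) :
    cell a (l + 1) x = cell a (l + 1) t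
      ↔ cell a 1 x = cell a 1 t ∧ cell a l (a * x) = cell a l (a * t) := by
  rw [cell_succ ha l x, cell_succ ha l t]
  have hx := cell_lt ha l (a * x)
  have ht := cell_lt ha l (a * t)
  constructor
  · intro h
    have h1 := congrArg (· % a ^ l) h
    simp only [Nat.add_mul_mod_self_left, Nat.mod_eq_of_lt hx, Nat.mod_eq_of_lt ht] at h1
    refine ⟨?_, h1⟩
    rw [h1] at h
    exact Nat.eq_of_mul_eq_mul_left (by positivity) (Nat.add_left_cancel h)
  · rintro ⟨h1, h2⟩
    rw [h1, h2]

theorem sum_range_mul_eq {M : Type*} [AddCommMonoid M] (b c : ℕ) (f : ℕ → M) :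
    ∑ n ∈ Finset.range (b * c), f n
      = ∑ j ∈ Finset.range c, ∑ i ∈ Finset.range b, f (i + b * j) := by
  induction c with
  | zero => simp
  | succ c ih =>
    rw [Nat.mul_succ, Finset.sum_range_add, ih, Finset.sum_range_succ]
    simp [add_comm]

theorem sum_rademacher_pow {a : ℕ} (ha : 2 ≤ a) (x t : ℝ) :
    ∑ d ∈ Finset.range a, rademacher a 0 x ^ d * conj (rademacher a 0 t ^ d)
      = if cell a 1 x = cell a 1 t then (a : ℂ) else 0 := by
  have hc : ∀ u, rademacher a 0 u = omega a ^ cell a 1 u := by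
    intro u
    simp [rademacher, cell]
  have hlt : ∀ u, cell a 1 u < a := fun u => by simpa using cell_lt ha 1 u
  split_ifs with h
  · have : ∀ d ∈ Finset.range a,
        rademacher a 0 x ^ d * conj (rademacher a 0 t ^ d) = 1 := by
      intro d _
      rw [map_pow, ← mul_pow, hc x, h, ← hc t, rademacher_mul_conj ha, one_pow]
    rw [Finset.sum_congr rfl this]
    simp
  · simp only [map_pow, ← mul_pow]
    set z := rademacher a 0 x * conj (rademacher a 0 t) with hz
    have hzt : z * rademacher a 0 t = rademacher a 0 x := by
      rw [hz, mul_assoc, mul_comm (conj _), rademacher_mul_conj ha, mul_one]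
    have hz1 : z ≠ 1 := by
      intro h1
      rw [h1, one_mul, hc, hc] at hzt
      exact h ((omega_isPrimitiveRoot ha).pow_inj (hlt t) (hlt x) hzt).symm
    have hza : z ^ a = 1 := by
      have : ∀ u, rademacher a 0 u ^ a = 1 := by
        intro u
        rw [hc, ← pow_mul, mul_comm, pow_mul, (omega_isPrimitiveRoot ha).pow_eq_one, one_pow]
      rw [hz, mul_pow, ← map_pow, this, this]
      simp
    rw [geom_sum_eq hz1, hza]
    simp

/-- The Dirichlet kernel of order `a ^ l` is a multiple of the indicator of the cells of
level `l`. -/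
theorem sum_walsh_kernel {a : ℕ} (ha : 2 ≤ a) (l : ℕ) :
    ∀ x t : ℝ, ∑ n ∈ Finset.range (a ^ l), walsh a n x * conj (walsh a n t)
      = if cell a l x = cell a l t then (a : ℂ) ^ l else 0 := by
  induction l with
  | zero => intro x t; simp [cell_level_zero]
  | succ l ih =>
    intro x t
    rw [pow_succ', sum_range_mul_eq]
    have : ∀ j ∈ Finset.range (a ^ l), ∑ i ∈ Finset.range a,
        walsh a (i + a * j) x * conj (walsh a (i + a * j) t)
        = (if cell a 1 x = cell a 1 t then (a : ℂ) else 0)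
          * (walsh a j (a * x) * conj (walsh a j (a * t))) := by
      intro j _
      rw [← sum_rademacher_pow ha, Finset.sum_mul]
      refine Finset.sum_congr rfl fun i hi => ?_
      rw [walsh_digit ha (Finset.mem_range.mp hi), walsh_digit ha (Finset.mem_range.mp hi),
        map_mul]
      ring
    rw [Finset.sum_congr rfl this, ← Finset.mul_sum, ih]
    simp only [cell_succ_eq_iff ha l x t]
    by_cases h1 : cell a 1 x = cell a 1 t <;>
      by_cases h2 : cell a l (a * x) = cell a l (a * t) <;> simp [h1, h2, pow_succ']

/-! ### Orthonormality -/

theorem intervalIntegrable_of_norm_le_one {h : ℝ → ℂ} (hm : Measurable h) (hb : ∀ x, ‖h x‖ ≤ 1)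
    (s t : ℝ) : IntervalIntegrable h volume s t :=
  (intervalIntegrable_const (c := (1 : ℝ))).mono_fun' hm.aestronglyMeasurable
    (Eventually.of_forall fun x => hb x)

theorem integral_comp_natCast_mul_of_periodic {h : ℝ → ℂ} (hp : Function.Periodic h 1)
    (hm : Measurable h) (hb : ∀ x, ‖h x‖ ≤ 1) {a : ℕ} (ha : a ≠ 0) :
    ∫ x in (0 : ℝ)..1, h (a * x) = ∫ x in (0 : ℝ)..1, h x := by
  have ha' : (a : ℝ) ≠ 0 := by exact_mod_cast ha
  have h1 := hp.intervalIntegral_add_zsmul_eq a 0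
    (fun s t => intervalIntegrable_of_norm_le_one hm hb s t)
  rw [intervalIntegral.integral_comp_mul_left _ ha']
  simp only [zero_add, natCast_zsmul, nsmul_eq_mul, mul_one] at h1
  rw [mul_zero, mul_one, h1, Complex.real_smul, ← mul_assoc]
  push_cast
  rw [inv_mul_cancel₀ (by exact_mod_cast ha), one_mul]

theorem integral_walsh_mul_conj_of_lt {a : ℕ} (ha : 2 ≤ a) (l : ℕ) :
    ∀ n m : ℕ, n < a ^ l → m < a ^ l →
      ∫ x in (0 : ℝ)..1, walsh a n x * conj (walsh a m x) = if n = m then 1 else 0 := by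
  induction l with
  | zero =>
    intro n m hn hm
    have h1 : n = 0 := by simpa using hn
    have h2 : m = 0 := by simpa using hm
    simp [h1, h2]
  | succ l ih =>
    intro n m hn hm
    have hpos : 0 < a := by omega
    have hn1 : n / a < a ^ l := Nat.div_lt_of_lt_mul (by rwa [pow_succ, mul_comm] at hn)
    have hm1 : m / a < a ^ l := Nat.div_lt_of_lt_mul (by rwa [pow_succ, mul_comm] at hm)
    have hn2 : n % a < a := Nat.mod_lt _ hpos
    have hm2 : m % a < a := Nat.mod_lt _ hpos
    set h : ℝ → ℂ := fun x => walsh a (n / a) x * conj (walsh a (m / a) x) with hh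
    have hper : Function.Periodic h 1 := fun x => by
      simp only [hh, walsh_periodic a _ x]
    have hmeas : Measurable h := (measurable_walsh _ _).mul
      (Complex.continuous_conj.measurable.comp (measurable_walsh _ _))
    have hle : ∀ x, ‖h x‖ ≤ 1 := fun x => by simp [hh, norm_walsh ha]
    have key : ∀ x, walsh a n x * conj (walsh a m x)
        = rademacher a 0 x ^ (n % a) * conj (rademacher a 0 x ^ (m % a)) * h (a * x) := by
      intro x
      conv_lhs => rw [← Nat.mod_add_div n a, ← Nat.mod_add_div m a]
      rw [walsh_digit ha hn2, walsh_digit ha hm2, map_mul, hh]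
      ring
    by_cases hd : n % a = m % a
    · have : ∀ x, walsh a n x * conj (walsh a m x) = h (a * x) := by
        intro x
        rw [key, hd, map_pow, ← mul_pow, rademacher_mul_conj ha, one_pow, one_mul]
      simp only [this]
      rw [integral_comp_natCast_mul_of_periodic hper hmeas hle hpos.ne', hh, ih _ _ hn1 hm1]
      congr 1
      rw [eq_iff_iff]
      constructor
      · intro h
        rw [← Nat.mod_add_div n a, ← Nat.mod_add_div m a, hd, h]
      · rintro rfl
        rfl
    · have hnm : n ≠ m := fun h => hd (by rw [h])
      rw [if_neg hnm]
      set H : ℝ → ℂ := fun x => walsh a n x * conj (walsh a m x) with hH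
      have hHper : Function.Periodic H 1 := fun x => by
        simp only [hH, walsh_periodic a _ x]
      -- A translation by `1 / a` multiplies the integrand by a nontrivial root of unity.
      have hshift : ∀ x, H (x + 1 / a)
          = omega a ^ (n % a) * conj (omega a ^ (m % a)) * H x := by
        intro x
        have ha0 : (a : ℝ) ≠ 0 := by positivity
        have e : (a : ℝ) * (x + 1 / a) = a * x + 1 := by field_simp
        simp only [hH, key]
        rw [rademacher_zero_shift ha, e, hper]
        simp only [mul_pow, map_mul]
        ring
      have hI : ∫ x in (0 : ℝ)..1, H (x + 1 / a) = ∫ x in (0 : ℝ)..1, H x := by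
        rw [intervalIntegral.integral_comp_add_right]
        have := hHper.intervalIntegral_add_eq (1 / (a : ℝ)) 0
        rw [zero_add, add_comm 1 (1 / (a : ℝ)), this, zero_add]
      simp only [hshift] at hI
      rw [intervalIntegral.integral_const_mul] at hI
      by_contra hne
      have hone : omega a ^ (n % a) * conj (omega a ^ (m % a)) = 1 := by
        have := mul_right_cancel₀ hne (hI.trans (one_mul _).symm)
        exact this
      have hun : omega a ^ (m % a) * conj (omega a ^ (m % a)) = 1 := by
        rw [Complex.mul_conj, Complex.normSq_eq_norm_sq, norm_pow, norm_omega ha]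
        simp
      have hc : conj (omega a ^ (m % a)) ≠ 0 := by
        intro h0
        rw [h0, mul_zero] at hun
        exact zero_ne_one hun
      exact hd ((omega_isPrimitiveRoot ha).pow_inj hn2 hm2
        (mul_right_cancel₀ hc (hone.trans hun.symm)))

theorem integral_walsh_mul_conj {a : ℕ} (ha : 2 ≤ a) (n m : ℕ) :
    ∫ x in Set.Icc (0 : ℝ) 1, walsh a n x * conj (walsh a m x) = if n = m then 1 else 0 := by
  rw [integral_Icc_eq_integral_Ioc, ← intervalIntegral.integral_of_le zero_le_one]
  have h : ∀ k : ℕ, k ≤ n + m → k < a ^ (n + m) := fun k hk =>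
    hk.trans_lt (Nat.lt_pow_self (by omega))
  exact integral_walsh_mul_conj_of_lt ha (n + m) n m (h n (by omega)) (h m (by omega))

/-! ### Walsh polynomials on the unit square -/

theorem measurableSet_unitSquare : MeasurableSet unitSquare :=
  measurableSet_Icc.prod measurableSet_Icc

theorem volume_unitSquare : volume unitSquare = 1 := by
  rw [unitSquare, Measure.volume_eq_prod, Measure.prod_prod]
  simp

theorem isCompact_unitSquare : IsCompact unitSquare := isCompact_Icc.prod isCompact_Icc

instance : IsProbabilityMeasure (volume.restrict unitSquare) :=
  ⟨by rw [Measure.restrict_apply_univ, volume_unitSquare]⟩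

@[fun_prop]
theorem measurable_walshTerm (a : ℕ) (c : ℕ+ × ℕ+ → ℂ) (i : ℕ+ × ℕ+) :
    Measurable (walshTerm a c i) := by
  unfold walshTerm
  exact (measurable_const.mul ((measurable_walsh a i.1).comp measurable_fst)).mul
    ((measurable_walsh a i.2).comp measurable_snd)

theorem norm_walshTerm {a : ℕ} (ha : 2 ≤ a) (c : ℕ+ × ℕ+ → ℂ) (i : ℕ+ × ℕ+) (p : ℝ × ℝ) :
    ‖walshTerm a c i p‖ = ‖c i‖ := by
  simp [walshTerm, norm_walsh ha]

theorem integral_walshTerm_mul_conj {a : ℕ} (ha : 2 ≤ a) (c : ℕ+ × ℕ+ → ℂ) (i j : ℕ+ × ℕ+) :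
    ∫ p in unitSquare, walshTerm a c i p * conj (walshTerm a c j p)
      = if i = j then c i * conj (c i) else 0 := by
  have h : ∀ p : ℝ × ℝ, walshTerm a c i p * conj (walshTerm a c j p)
      = c i * conj (c j) * ((walsh a i.1 p.1 * conj (walsh a j.1 p.1))
        * (walsh a i.2 p.2 * conj (walsh a j.2 p.2))) := by
    intro p
    simp only [walshTerm, map_mul]
    ring
  simp only [h]
  rw [integral_const_mul, unitSquare, Measure.volume_eq_prod, ← Measure.prod_restrict,
    integral_prod_mul (fun x => walsh a i.1 x * conj (walsh a j.1 x))
      (fun y => walsh a i.2 y * conj (walsh a j.2 y)),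
    integral_walsh_mul_conj ha, integral_walsh_mul_conj ha]
  by_cases hij : i = j
  · simp [hij]
  · rw [if_neg hij]
    rcases not_and_or.mp (fun h => hij (Prod.ext_iff.mpr h)) with h | h
    · rw [if_neg (fun e => h (PNat.coe_injective e))]; simp
    · rw [if_neg (c := (i.2 : ℕ) = j.2) (fun e => h (PNat.coe_injective e))]; simp

theorem integrable_of_measurable_of_norm_le {h : ℝ × ℝ → ℂ} (hm : Measurable h) {C : ℝ}
    (hb : ∀ p, ‖h p‖ ≤ C) : Integrable h (volume.restrict unitSquare) :=
  Integrable.of_bound hm.aestronglyMeasurable C (Eventually.of_forall hb)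

theorem norm_sum_walshTerm_le {a : ℕ} (ha : 2 ≤ a) (c : ℕ+ × ℕ+ → ℂ) (A : Finset (ℕ+ × ℕ+))
    (p : ℝ × ℝ) : ‖∑ i ∈ A, walshTerm a c i p‖ ≤ ∑ i ∈ A, ‖c i‖ :=
  (norm_sum_le _ _).trans (Finset.sum_le_sum fun i _ => (norm_walshTerm ha c i p).le)

theorem integral_norm_sq_sum_walshTerm {a : ℕ} (ha : 2 ≤ a) (c : ℕ+ × ℕ+ → ℂ)
    (A : Finset (ℕ+ × ℕ+)) :
    ∫ p in unitSquare, ‖∑ i ∈ A, walshTerm a c i p‖ ^ 2 = ∑ i ∈ A, ‖c i‖ ^ 2 := by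
  have hint : ∀ i j, Integrable (fun p => walshTerm a c i p * conj (walshTerm a c j p))
      (volume.restrict unitSquare) := by
    intro i j
    refine integrable_of_measurable_of_norm_le (C := ‖c i‖ * ‖c j‖) ?_ ?_
    · exact (measurable_walshTerm a c i).mul
        (Complex.continuous_conj.measurable.comp (measurable_walshTerm a c j))
    · intro p
      simp [norm_walshTerm ha]
  have h : ∫ p in unitSquare, (((‖∑ i ∈ A, walshTerm a c i p‖ ^ 2 : ℝ)) : ℂ)
      = ∑ i ∈ A, ((‖c i‖ ^ 2 : ℝ) : ℂ) := by
    have e : ∀ p, ((‖∑ i ∈ A, walshTerm a c i p‖ ^ 2 : ℝ) : ℂ)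
        = ∑ i ∈ A, ∑ j ∈ A, walshTerm a c i p * conj (walshTerm a c j p) := by
      intro p
      rw [← Finset.sum_mul_sum, ← map_sum, Complex.mul_conj']
      push_cast
      rfl
    simp only [e]
    rw [integral_finsetSum _ fun i _ => integrable_finsetSum _ fun j _ => hint i j]
    refine Finset.sum_congr rfl fun i hi => ?_
    rw [integral_finsetSum _ fun j _ => hint i j]
    simp only [integral_walshTerm_mul_conj ha]
    rw [Finset.sum_ite_eq, if_pos hi, Complex.mul_conj']
    push_cast
    rfl
  rw [integral_complex_ofReal] at h
  exact_mod_cast h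

/-- The `L¹` norm of a Walsh polynomial is bounded by its `L²` norm, which is the `ℓ²` norm of
the coefficients. -/
theorem lintegral_sum_walshTerm_le {a : ℕ} (ha : 2 ≤ a) (c : ℕ+ × ℕ+ → ℂ)
    (A : Finset (ℕ+ × ℕ+)) {δ : ℝ} (hδ : 0 < δ) (hA : ∑ i ∈ A, ‖c i‖ ^ 2 ≤ δ ^ 2) :
    ∫⁻ p in unitSquare, ‖∑ i ∈ A, walshTerm a c i p‖ₑ ≤ ENNReal.ofReal δ := by
  have hm : Measurable fun p => ∑ i ∈ A, walshTerm a c i p := by fun_prop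
  have hb := norm_sum_walshTerm_le ha c A
  have hi := integrable_of_measurable_of_norm_le hm hb
  have hi2 : Integrable (fun p => ‖∑ i ∈ A, walshTerm a c i p‖ ^ 2)
      (volume.restrict unitSquare) := by
    refine Integrable.of_bound (hm.norm.pow_const 2).aestronglyMeasurable
      ((∑ i ∈ A, ‖c i‖) ^ 2) (Eventually.of_forall fun p => ?_)
    rw [Real.norm_of_nonneg (by positivity)]
    exact pow_le_pow_left₀ (norm_nonneg _) (hb p) 2
  rw [← ofReal_integral_norm_eq_lintegral_enorm hi]
  refine ENNReal.ofReal_le_ofReal ?_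
  -- The inequality `2 δ t ≤ t ^ 2 + δ ^ 2` replaces that of Cauchy and Schwarz.
  calc ∫ p in unitSquare, ‖∑ i ∈ A, walshTerm a c i p‖
      ≤ ∫ p in unitSquare, ((2 * δ)⁻¹ * ‖∑ i ∈ A, walshTerm a c i p‖ ^ 2 + δ / 2) := by
        refine integral_mono hi.norm ((hi2.const_mul _).add (integrable_const _)) fun p => ?_
        have h := sq_nonneg (‖∑ i ∈ A, walshTerm a c i p‖ - δ)
        have : (2 * δ)⁻¹ * ‖∑ i ∈ A, walshTerm a c i p‖ ^ 2 + δ / 2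
            - ‖∑ i ∈ A, walshTerm a c i p‖
            = (2 * δ)⁻¹ * (‖∑ i ∈ A, walshTerm a c i p‖ - δ) ^ 2 := by
          field_simp
          ring
        have h2 : 0 ≤ (2 * δ)⁻¹ * (‖∑ i ∈ A, walshTerm a c i p‖ - δ) ^ 2 := by positivity
        simp only
        linarith
    _ = (2 * δ)⁻¹ * ∑ i ∈ A, ‖c i‖ ^ 2 + δ / 2 := by
        rw [integral_add (hi2.const_mul _) (integrable_const _), integral_const_mul,
          integral_norm_sq_sum_walshTerm ha]
        simp
    _ ≤ (2 * δ)⁻¹ * δ ^ 2 + δ / 2 := by gcongr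
    _ = δ := by field_simp; norm_num

/-! ### Localized oscillating factors -/

/-- The frequencies `n + a ^ s * m` with `n < a ^ l` and `1 ≤ m < a ^ r`: the spectrum of the
indicator of a cell of level `l` times a mean zero function of the digits
`s, …, s + r - 1`. -/
def freqSet (a l r s : ℕ) : Finset ℕ+ :=
  (Finset.range (a ^ l) ×ˢ Finset.Ico 1 (a ^ r)).image fun q => (q.1 + a ^ s * q.2).toPNat'

theorem mem_freqSet_bounds {a l r s : ℕ} (ha : 2 ≤ a) (hls : l ≤ s) {N : ℕ+}
    (hN : N ∈ freqSet a l r s) : a ^ s ≤ (N : ℕ) ∧ (N : ℕ) < a ^ (s + r) := by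
  simp only [freqSet, Finset.mem_image, Finset.mem_product, Finset.mem_range,
    Finset.mem_Ico] at hN
  obtain ⟨⟨n, m⟩, ⟨hn, hm1, hm2⟩, rfl⟩ := hN
  have hs : 0 < a ^ s := by positivity
  have hns : n < a ^ s := hn.trans_le (Nat.pow_le_pow_right (by omega) hls)
  have hp : 0 < n + a ^ s * m := by positivity
  simp only [Nat.toPNat'_coe, hp, if_true, pow_add]
  constructor
  · nlinarith
  · nlinarith

theorem sum_freqSet {M : Type*} [AddCommMonoid M] {a l r s : ℕ} (ha : 2 ≤ a) (hls : l ≤ s)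
    (f : ℕ → M) :
    ∑ N ∈ freqSet a l r s, f N
      = ∑ n ∈ Finset.range (a ^ l), ∑ m ∈ Finset.Ico 1 (a ^ r), f (n + a ^ s * m) := by
  have hpos : ∀ q ∈ Finset.range (a ^ l) ×ˢ Finset.Ico 1 (a ^ r),
      ((q.1 + a ^ s * q.2).toPNat' : ℕ) = q.1 + a ^ s * q.2 := by
    intro q hq
    simp only [Finset.mem_product, Finset.mem_Ico] at hq
    have hs : 0 < a ^ s := by positivity
    have : 0 < q.1 + a ^ s * q.2 := by nlinarith
    simp [this]
  rw [freqSet, Finset.sum_image, Finset.sum_product]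
  · refine Finset.sum_congr rfl fun n hn => Finset.sum_congr rfl fun m hm => ?_
    rw [hpos (n, m) (Finset.mk_mem_product hn hm)]
  · intro q hq q' hq' h
    have h1 := congrArg PNat.val h
    have e : q.1 + a ^ s * q.2 = q'.1 + a ^ s * q'.2 :=
      (hpos q hq).symm.trans (h1.trans (hpos q' hq'))
    have hlt : ∀ q : ℕ × ℕ, q ∈ Finset.range (a ^ l) ×ˢ Finset.Ico 1 (a ^ r) → q.1 < a ^ s :=
      fun q hq => (Finset.mem_range.mp (Finset.mem_product.mp hq).1).trans_le
        (Nat.pow_le_pow_right (by omega) hls)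
    have e1 : q.1 = q'.1 := by
      have := congrArg (· % a ^ s) e
      simpa [Nat.add_mul_mod_self_left, Nat.mod_eq_of_lt (hlt q hq),
        Nat.mod_eq_of_lt (hlt q' hq')] using this
    rw [e1] at e
    exact Prod.ext e1 (Nat.eq_of_mul_eq_mul_left (by positivity) (Nat.add_left_cancel e))

theorem card_freqSet {a l r s : ℕ} : (freqSet a l r s).card ≤ a ^ l * a ^ r := by
  refine Finset.card_image_le.trans ?_
  rw [Finset.card_product, Finset.card_range, Nat.card_Ico]
  exact Nat.mul_le_mul_left _ (Nat.sub_le _ _)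

theorem walsh_natCast (a n k : ℕ) : walsh a n (k : ℝ) = 1 := by
  have := (walsh_periodic a n).nat_mul_eq k
  rw [mul_one] at this
  rw [this, walsh_at_zero]

theorem walsh_add_mul_pow_natCast_div {a : ℕ} (ha : 2 ≤ a) {l s n : ℕ} (hls : l ≤ s)
    (hn : n < a ^ s) (m i : ℕ) :
    walsh a (n + a ^ s * m) ((i : ℝ) / (a : ℝ) ^ l) = walsh a n ((i : ℝ) / (a : ℝ) ^ l) := by
  have h : (a : ℝ) ^ s * ((i : ℝ) / (a : ℝ) ^ l) = ((a ^ (s - l) * i : ℕ) : ℝ) := by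
    have : (a : ℝ) ^ s = (a : ℝ) ^ (s - l) * (a : ℝ) ^ l := by
      rw [← pow_add, Nat.sub_add_cancel hls]
    rw [this]
    push_cast
    field_simp
  rw [walsh_add_mul_pow ha s hn, h, walsh_natCast, mul_one]

theorem sum_walsh_eq {a : ℕ} (ha : 2 ≤ a) (r : ℕ) (u : ℝ) :
    ∑ m ∈ Finset.range (a ^ r), walsh a m u = if cell a r u = 0 then (a : ℂ) ^ r else 0 := by
  have := sum_walsh_kernel ha r u 0
  simpa [walsh_at_zero, cell_at_zero] using this

/-- The spectrum of the product of the indicator of the cell `i` with a Walsh polynomial in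
`a ^ s * x`. The coefficients do not involve `m`, because `a ^ s * (i / a ^ l)` is an integer. -/
theorem sum_sum_walsh_shift {a : ℕ} (ha : 2 ≤ a) {l s : ℕ} (hls : l ≤ s) {i : ℕ}
    (hi : i < a ^ l) (Q : Finset ℕ) (x : ℝ) :
    ∑ n ∈ Finset.range (a ^ l), ∑ m ∈ Q,
        conj (walsh a (n + a ^ s * m) ((i : ℝ) / (a : ℝ) ^ l)) * walsh a (n + a ^ s * m) x
      = (if cell a l x = i then (a : ℂ) ^ l else 0) * ∑ m ∈ Q, walsh a m ((a : ℝ) ^ s * x) := by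
  have hk := sum_walsh_kernel ha l x ((i : ℝ) / (a : ℝ) ^ l)
  rw [cell_natCast_div ha hi] at hk
  rw [← hk, Finset.sum_mul]
  refine Finset.sum_congr rfl fun n hn => ?_
  rw [Finset.mul_sum]
  refine Finset.sum_congr rfl fun m _ => ?_
  have hns : n < a ^ s :=
    (Finset.mem_range.mp hn).trans_le (Nat.pow_le_pow_right (by omega) hls)
  rw [walsh_add_mul_pow_natCast_div ha hls hns, walsh_add_mul_pow ha s hns]
  ring

/-- The factor of a block: it is supported on one cell of level `l`, and equals `-1` there off a
set of proportion `a ^ (-r)`. -/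
theorem sum_freqSet_walsh {a : ℕ} (ha : 2 ≤ a) {l r s : ℕ} (hls : l ≤ s) {i : ℕ}
    (hi : i < a ^ l) (x : ℝ) :
    ∑ N ∈ freqSet a l r s, conj (walsh a N ((i : ℝ) / (a : ℝ) ^ l)) * walsh a N x
      = (if cell a l x = i then (a : ℂ) ^ l else 0)
        * ((if cell a r ((a : ℝ) ^ s * x) = 0 then (a : ℂ) ^ r else 0) - 1) := by
  rw [sum_freqSet ha hls (fun N => conj (walsh a N ((i : ℝ) / (a : ℝ) ^ l)) * walsh a N x),
    sum_sum_walsh_shift ha hls hi, ← sum_walsh_eq ha, Finset.range_eq_Ico,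
    Finset.sum_eq_sum_Ico_succ_bot (by positivity : 0 < a ^ r)]
  simp

/-- The part of the cell `i` of level `l` where the digits `s, …, s + r - 1` vanish. -/
def zeroDigits (a l r s i : ℕ) : Set ℝ :=
  {x | x ∈ Set.Icc (0 : ℝ) 1 ∧ cell a l x = i ∧ cell a r ((a : ℝ) ^ s * x) = 0}

theorem measurableSet_zeroDigits (a l r s i : ℕ) : MeasurableSet (zeroDigits a l r s i) := by
  refine measurableSet_Icc.inter (MeasurableSet.inter ?_ ?_)
  · exact measurable_cell a l (measurableSet_singleton i)
  · exact (measurable_cell a r).comp (measurable_const_mul _) (measurableSet_singleton 0)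

theorem volume_zeroDigits {a : ℕ} (ha : 2 ≤ a) {l s : ℕ} (r : ℕ) (hls : l ≤ s) {i : ℕ}
    (hi : i < a ^ l) :
    volume (zeroDigits a l r s i) = ENNReal.ofReal (((a : ℝ) ^ l)⁻¹ * ((a : ℝ) ^ r)⁻¹) := by
  have ha0 : (a : ℂ) ≠ 0 := by
    have : a ≠ 0 := by omega
    exact_mod_cast this
  have hint : ∀ N : ℕ, Integrable (walsh a N) (volume.restrict (Set.Icc (0 : ℝ) 1)) :=
    fun N => Integrable.of_bound (measurable_walsh a N).aestronglyMeasurable 1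
      (Eventually.of_forall fun x => (norm_walsh ha N x).le)
  have hI : ∀ N : ℕ, ∫ x in Set.Icc (0 : ℝ) 1, walsh a N x = if N = 0 then 1 else 0 := by
    intro N
    simpa using integral_walsh_mul_conj ha N 0
  have hind : ∀ x ∈ Set.Icc (0 : ℝ) 1,
      ((zeroDigits a l r s i).indicator (fun _ => (1 : ℂ)) x)
      = ((a : ℂ) ^ l)⁻¹ * ((a : ℂ) ^ r)⁻¹
        * ∑ n ∈ Finset.range (a ^ l), ∑ m ∈ Finset.range (a ^ r),
          conj (walsh a (n + a ^ s * m) ((i : ℝ) / (a : ℝ) ^ l)) * walsh a (n + a ^ s * m) x := by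
    intro x hx
    rw [sum_sum_walsh_shift ha hls hi, sum_walsh_eq ha]
    by_cases h1 : cell a l x = i <;> by_cases h2 : cell a r ((a : ℝ) ^ s * x) = 0 <;>
      simp [zeroDigits, h1, h2, hx, Set.indicator, -Set.mem_Icc]
    field_simp
  have h1 : ∫ x in Set.Icc (0 : ℝ) 1, ((zeroDigits a l r s i).indicator (fun _ => (1 : ℂ)) x)
      = ((a : ℂ) ^ l)⁻¹ * ((a : ℂ) ^ r)⁻¹ := by
    rw [setIntegral_congr_fun measurableSet_Icc hind, integral_const_mul,
      integral_finsetSum _ fun n _ => integrable_finsetSum _ fun m _ => (hint _).const_mul _]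
    simp_rw [integral_finsetSum _ fun m _ => (hint _).const_mul _, integral_const_mul, hI]
    have hz : ∀ n m : ℕ, (n + a ^ s * m = 0) ↔ (n = 0 ∧ m = 0) := by
      intro n m
      have : a ^ s ≠ 0 := by positivity
      rw [Nat.add_eq_zero_iff, Nat.mul_eq_zero, or_iff_right this]
    rw [Finset.sum_eq_single 0, Finset.sum_eq_single 0]
    · simp
    · intro m _ hm
      rw [if_neg fun h => hm ((hz _ _).mp h).2, mul_zero]
    · intro h
      exact absurd (Finset.mem_range.mpr (by positivity)) h
    · intro n _ hn
      refine Finset.sum_eq_zero fun m _ => ?_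
      rw [if_neg fun h => hn ((hz _ _).mp h).1, mul_zero]
    · intro h
      exact absurd (Finset.mem_range.mpr (by positivity)) h
  have hsub : zeroDigits a l r s i ⊆ Set.Icc 0 1 := fun x hx => hx.1
  rw [integral_indicator (measurableSet_zeroDigits a l r s i),
    Measure.restrict_restrict (measurableSet_zeroDigits a l r s i),
    Set.inter_eq_left.mpr hsub, setIntegral_const] at h1
  have hfin : volume (zeroDigits a l r s i) ≠ ⊤ :=
    (measure_mono hsub).trans_lt (by simp) |>.ne
  have h2 : volume.real (zeroDigits a l r s i) = ((a : ℝ) ^ l)⁻¹ * ((a : ℝ) ^ r)⁻¹ := by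
    have : ((volume.real (zeroDigits a l r s i) : ℝ) : ℂ)
        = ((((a : ℝ) ^ l)⁻¹ * ((a : ℝ) ^ r)⁻¹ : ℝ) : ℂ) := by
      push_cast
      rw [← h1]
      simp
    exact_mod_cast this
  rw [← h2, Measure.real, ENNReal.ofReal_toReal hfin]

/-! ### Blocks attached to the cells of the square -/

/-- The cells of level `l` of the square, numbered row by row: the number of the cell that
contains `p`. -/
noncomputable def cellIndex (a l : ℕ) (p : ℝ × ℝ) : ℕ := cell a l p.1 * a ^ l + cell a l p.2

/-- The lower left corner of the cell number `t` of level `l`. -/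
noncomputable def corner (a l t : ℕ) : ℝ × ℝ :=
  (((t / a ^ l : ℕ) : ℝ) / (a : ℝ) ^ l, ((t % a ^ l : ℕ) : ℝ) / (a : ℝ) ^ l)

theorem cellIndex_lt {a : ℕ} (ha : 2 ≤ a) (l : ℕ) (p : ℝ × ℝ) :
    cellIndex a l p < a ^ l * a ^ l := by
  have h1 := cell_lt ha l p.1
  have h2 := cell_lt ha l p.2
  unfold cellIndex
  nlinarith

theorem cellIndex_div {a : ℕ} (ha : 2 ≤ a) (l : ℕ) (p : ℝ × ℝ) :
    cellIndex a l p / a ^ l = cell a l p.1 := by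
  rw [cellIndex, mul_comm, Nat.mul_add_div (by positivity), Nat.div_eq_of_lt (cell_lt ha l p.2),
    add_zero]

theorem cellIndex_mod {a : ℕ} (ha : 2 ≤ a) (l : ℕ) (p : ℝ × ℝ) :
    cellIndex a l p % a ^ l = cell a l p.2 := by
  rw [cellIndex, mul_comm, Nat.mul_add_mod, Nat.mod_eq_of_lt (cell_lt ha l p.2)]

theorem cellIndex_eq_iff {a : ℕ} (ha : 2 ≤ a) (l : ℕ) (p : ℝ × ℝ) (t : ℕ) :
    cellIndex a l p = t ↔ cell a l p.1 = t / a ^ l ∧ cell a l p.2 = t % a ^ l := by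
  constructor
  · rintro rfl
    exact ⟨(cellIndex_div ha l p).symm, (cellIndex_mod ha l p).symm⟩
  · rintro ⟨h1, h2⟩
    rw [cellIndex, h1, h2, mul_comm, Nat.div_add_mod]

theorem corner_mem {a : ℕ} (ha : 2 ≤ a) {l t : ℕ} (ht : t < a ^ l * a ^ l) :
    corner a l t ∈ unitSquare := by
  have hM : (0 : ℝ) < (a : ℝ) ^ l := by positivity
  have h : ∀ i : ℕ, i < a ^ l → (i : ℝ) / (a : ℝ) ^ l ∈ Set.Icc (0 : ℝ) 1 := by
    intro i hi
    have : (i : ℝ) ≤ (a : ℝ) ^ l := by exact_mod_cast hi.le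
    exact ⟨by positivity, (div_le_one hM).mpr this⟩
  exact ⟨h _ (Nat.div_lt_of_lt_mul ht), h _ (Nat.mod_lt _ (by positivity))⟩

theorem dist_cell_le {a : ℕ} (ha : 2 ≤ a) (l : ℕ) {x : ℝ} (hx : x ∈ Set.Ico (0 : ℝ) 1) :
    dist x ((cell a l x : ℝ) / (a : ℝ) ^ l) ≤ ((a : ℝ) ^ l)⁻¹ := by
  have hM : (0 : ℝ) < (a : ℝ) ^ l := by positivity
  have hf : Int.fract x = x := Int.fract_eq_self.mpr hx
  have h0 : 0 ≤ (a : ℝ) ^ l * x := mul_nonneg hM.le hx.1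
  have h1 := Nat.floor_le h0
  have h2 := (Nat.lt_floor_add_one ((a : ℝ) ^ l * x)).le
  rw [cell, hf, Real.dist_eq]
  have e : x - (⌊(a : ℝ) ^ l * x⌋₊ : ℝ) / (a : ℝ) ^ l
      = ((a : ℝ) ^ l * x - ⌊(a : ℝ) ^ l * x⌋₊) * ((a : ℝ) ^ l)⁻¹ := by field_simp
  rw [e, abs_mul, abs_of_pos (inv_pos.mpr hM), abs_of_nonneg (by linarith)]
  exact mul_le_of_le_one_left (inv_pos.mpr hM).le (by linarith)

theorem dist_corner_le {a : ℕ} (ha : 2 ≤ a) (l : ℕ) {p : ℝ × ℝ}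
    (hp : p ∈ Set.Ico (0 : ℝ) 1 ×ˢ Set.Ico (0 : ℝ) 1) :
    dist p (corner a l (cellIndex a l p)) ≤ ((a : ℝ) ^ l)⁻¹ := by
  rw [corner, cellIndex_div ha, cellIndex_mod ha, Prod.dist_eq]
  exact max_le (dist_cell_le ha l hp.1) (dist_cell_le ha l hp.2)

/-- The spectrum of one block. -/
def blockIndex (a l r s : ℕ) : Finset (ℕ+ × ℕ+) := freqSet a l r s ×ˢ freqSet a l r s

/-- The coefficients of the block that carries the value `γ` on the cell number `t`. -/
noncomputable def blockCoeff (a l : ℕ) (γ : ℂ) (t : ℕ) (i : ℕ+ × ℕ+) : ℂ :=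
  γ * (((a : ℂ) ^ l)⁻¹) ^ 2
    * (conj (walsh a i.1 (corner a l t).1) * conj (walsh a i.2 (corner a l t).2))

theorem norm_blockCoeff {a : ℕ} (ha : 2 ≤ a) (l : ℕ) (γ : ℂ) (t : ℕ) (i : ℕ+ × ℕ+) :
    ‖blockCoeff a l γ t i‖ = ‖γ‖ * (((a : ℝ) ^ l)⁻¹) ^ 2 := by
  simp [blockCoeff, norm_walsh ha]

theorem card_blockIndex (a l r s : ℕ) :
    ((blockIndex a l r s).card : ℝ) ≤ ((a : ℝ) ^ l * (a : ℝ) ^ r) ^ 2 := by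
  have h : ((freqSet a l r s).card : ℝ) ≤ (a : ℝ) ^ l * (a : ℝ) ^ r := by
    exact_mod_cast card_freqSet
  rw [blockIndex, Finset.card_product, sq]
  push_cast
  gcongr

/-- Off the small set where the extra digits vanish, a complete block is the indicator of its
cell times `γ`: the two factors equal to `-1` cancel. -/
theorem sum_block {a : ℕ} (ha : 2 ≤ a) {l r s : ℕ} (hls : l ≤ s) {t : ℕ}
    (ht : t < a ^ l * a ^ l) (γ : ℂ) {p : ℝ × ℝ} (hp : p ∈ unitSquare)
    (h : t = cellIndex a l p →
      p.1 ∉ zeroDigits a l r s (t / a ^ l) ∧ p.2 ∉ zeroDigits a l r s (t % a ^ l)) :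
    ∑ i ∈ blockIndex a l r s, walshTerm a (blockCoeff a l γ t) i p
      = if cellIndex a l p = t then γ else 0 := by
  have hM : ((a : ℂ) ^ l) ≠ 0 := by
    have : a ≠ 0 := by omega
    exact pow_ne_zero _ (by exact_mod_cast this)
  have hsum : ∑ i ∈ blockIndex a l r s, walshTerm a (blockCoeff a l γ t) i p
      = γ * (((a : ℂ) ^ l)⁻¹) ^ 2
        * ((∑ N ∈ freqSet a l r s, conj (walsh a N (corner a l t).1) * walsh a N p.1)
          * ∑ N ∈ freqSet a l r s, conj (walsh a N (corner a l t).2) * walsh a N p.2) := by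
    rw [Finset.sum_mul_sum, ← Finset.sum_product', Finset.mul_sum]
    refine Finset.sum_congr rfl fun i _ => ?_
    rw [walshTerm, blockCoeff]
    ring
  rw [hsum, corner, sum_freqSet_walsh ha hls (Nat.div_lt_of_lt_mul ht),
    sum_freqSet_walsh ha hls (Nat.mod_lt _ (by positivity))]
  by_cases hc : cellIndex a l p = t
  · obtain ⟨c1, c2⟩ := (cellIndex_eq_iff ha l p t).mp hc
    have z1 : ¬ cell a r ((a : ℝ) ^ s * p.1) = 0 := fun z => (h hc.symm).1 ⟨hp.1, c1, z⟩
    have z2 : ¬ cell a r ((a : ℝ) ^ s * p.2) = 0 := fun z => (h hc.symm).2 ⟨hp.2, c2, z⟩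
    rw [if_pos c1, if_pos c2, if_neg z1, if_neg z2, if_pos hc]
    field_simp
    ring
  · rw [if_neg hc]
    rcases not_and_or.mp (fun h => hc ((cellIndex_eq_iff ha l p t).mpr h)) with h | h
    · rw [if_neg h]; ring
    · rw [if_neg h]; ring

/-- The coefficients of the sum of the first `T` blocks, where block `t` uses the scale
`s₀ + r * t`, so that the spectra of the blocks are disjoint. -/
noncomputable def polyCoeff (a l r s₀ : ℕ) (γ : ℕ → ℂ) (T : ℕ) (i : ℕ+ × ℕ+) : ℂ :=
  ∑ t ∈ Finset.range T,
    if i ∈ blockIndex a l r (s₀ + r * t) then blockCoeff a l (γ t) t i else 0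

theorem mem_blockIndex_bounds {a l r s : ℕ} (ha : 2 ≤ a) (hls : l ≤ s) {i : ℕ+ × ℕ+}
    (hi : i ∈ blockIndex a l r s) : a ^ s ≤ (i.1 : ℕ) ∧ (i.1 : ℕ) < a ^ (s + r) :=
  mem_freqSet_bounds ha hls (Finset.mem_product.mp hi).1

theorem blockIndex_unique {a l r s₀ : ℕ} (ha : 2 ≤ a) (hls : l ≤ s₀) {t t' : ℕ} {i : ℕ+ × ℕ+}
    (hi : i ∈ blockIndex a l r (s₀ + r * t)) (hi' : i ∈ blockIndex a l r (s₀ + r * t')) :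
    t = t' := by
  have key : ∀ t t' : ℕ, i ∈ blockIndex a l r (s₀ + r * t) →
      i ∈ blockIndex a l r (s₀ + r * t') → ¬ t < t' := by
    intro t t' hi hi' hlt
    have h1 := (mem_blockIndex_bounds ha (by omega) hi).2
    have h2 := (mem_blockIndex_bounds ha (by omega) hi').1
    have h3 : s₀ + r * t + r ≤ s₀ + r * t' := by
      have : r * (t + 1) ≤ r * t' := Nat.mul_le_mul_left _ hlt
      linarith [this, Nat.mul_succ r t]
    have h4 : a ^ (s₀ + r * t + r) ≤ a ^ (s₀ + r * t') := Nat.pow_le_pow_right (by omega) h3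
    omega
  exact le_antisymm (not_lt.mp (key _ _ hi' hi)) (not_lt.mp (key _ _ hi hi'))

theorem polyCoeff_eq {a l r s₀ : ℕ} (ha : 2 ≤ a) (hls : l ≤ s₀) (γ : ℕ → ℂ) {T t : ℕ}
    (ht : t < T) {i : ℕ+ × ℕ+} (hi : i ∈ blockIndex a l r (s₀ + r * t)) :
    polyCoeff a l r s₀ γ T i = blockCoeff a l (γ t) t i := by
  rw [polyCoeff, Finset.sum_eq_single t, if_pos hi]
  · intro t' _ hne
    exact if_neg fun h => hne (blockIndex_unique ha hls h hi)
  · intro h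
    exact absurd (Finset.mem_range.mpr ht) h

theorem polyCoeff_eq_zero {a l r s₀ : ℕ} (γ : ℕ → ℂ) {T : ℕ} {i : ℕ+ × ℕ+}
    (hi : ∀ t < T, i ∉ blockIndex a l r (s₀ + r * t)) : polyCoeff a l r s₀ γ T i = 0 :=
  Finset.sum_eq_zero fun t ht => if_neg (hi t (Finset.mem_range.mp ht))

/-- The indices of the first `T` blocks, block by block. -/
noncomputable def polyList (a l r s₀ T : ℕ) : List (ℕ+ × ℕ+) :=
  (List.range T).flatMap fun t => (blockIndex a l r (s₀ + r * t)).toList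

theorem mem_polyList {a l r s₀ T : ℕ} {i : ℕ+ × ℕ+} :
    i ∈ polyList a l r s₀ T ↔ ∃ t < T, i ∈ blockIndex a l r (s₀ + r * t) := by
  simp [polyList]

theorem nodup_polyList {a l r s₀ : ℕ} (ha : 2 ≤ a) (hls : l ≤ s₀) (T : ℕ) :
    (polyList a l r s₀ T).Nodup := by
  rw [polyList, List.nodup_flatMap]
  refine ⟨fun t _ => Finset.nodup_toList _, ?_⟩
  refine List.Pairwise.imp_of_mem ?_ (List.nodup_range (n := T))
  intro t t' _ _ hne i hi hi'
  exact hne (blockIndex_unique ha hls (Finset.mem_toList.mp hi) (Finset.mem_toList.mp hi'))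

theorem length_polyList_le (a l r s₀ T : ℕ) :
    ((polyList a l r s₀ T).length : ℝ) ≤ T * ((a : ℝ) ^ l * (a : ℝ) ^ r) ^ 2 := by
  induction T with
  | zero => simp [polyList]
  | succ T ih =>
    have : polyList a l r s₀ (T + 1)
        = polyList a l r s₀ T ++ (blockIndex a l r (s₀ + r * T)).toList := by
      simp [polyList, List.range_succ]
    rw [this, List.length_append, Finset.length_toList]
    push_cast
    have := card_blockIndex a l r (s₀ + r * T)
    linarith

theorem prefix_append_cases {α : Type*} {L A B : List α} (h : L <+: A ++ B) :
    L <+: A ∨ ∃ L', L = A ++ L' ∧ L' <+: B := by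
  obtain ⟨K, hK⟩ := h
  rcases List.append_eq_append_iff.mp hK with ⟨D, h1, _⟩ | ⟨D, h1, h2⟩
  · exact Or.inl ⟨D, h1.symm⟩
  · exact Or.inr ⟨D, h1, ⟨K, h2.symm⟩⟩

/-- A prefix of a concatenation of blocks consists of complete blocks and a part of one more. -/
theorem prefix_flatMap_range {α : Type*} (B : ℕ → List α) (T : ℕ) :
    ∀ L' : List α, L' <+: (List.range T).flatMap B →
      ∃ τ ≤ T, ∃ L'' : List α, L' = (List.range τ).flatMap B ++ L'' ∧
        (L'' = [] ∨ τ < T ∧ L'' <+: B τ) := by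
  induction T with
  | zero =>
    intro L' h
    exact ⟨0, le_rfl, [], by simpa using h, Or.inl rfl⟩
  | succ T ih =>
    intro L' h
    rw [List.range_succ, List.flatMap_append, List.flatMap_singleton] at h
    rcases prefix_append_cases h with h | ⟨L'', h1, h2⟩
    · obtain ⟨τ, hτ, L'', h1, h2⟩ := ih L' h
      exact ⟨τ, hτ.trans T.le_succ, L'', h1, h2.imp_right fun h => ⟨h.1.trans T.lt_succ_self, h.2⟩⟩
    · exact ⟨T, T.le_succ, L'', h1, Or.inr ⟨T.lt_succ_self, h2⟩⟩

theorem sum_map_polyList {a l r s₀ : ℕ} (f : ℕ+ × ℕ+ → ℂ) (τ : ℕ) :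
    ((polyList a l r s₀ τ).map f).sum
      = ∑ t ∈ Finset.range τ, ∑ i ∈ blockIndex a l r (s₀ + r * t), f i := by
  induction τ with
  | zero => simp [polyList]
  | succ τ ih =>
    have : polyList a l r s₀ (τ + 1)
        = polyList a l r s₀ τ ++ (blockIndex a l r (s₀ + r * τ)).toList := by
      simp [polyList, List.range_succ]
    rw [this, List.map_append, List.sum_append, ih, Finset.sum_range_succ,
      Finset.sum_map_toList]

/-- The points of the square where some block differs from the step function it represents,
together with the two sides of the square on which the cells are taken modulo one. -/
def badSet (a l r s₀ : ℕ) : Set (ℝ × ℝ) :=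
  (unitSquare \ Set.Ico (0 : ℝ) 1 ×ˢ Set.Ico (0 : ℝ) 1) ∪
  ⋃ t ∈ Finset.range (a ^ l * a ^ l),
    zeroDigits a l r (s₀ + r * t) (t / a ^ l) ×ˢ
      zeroDigits a l 0 (s₀ + r * t) (t % a ^ l) ∪
    zeroDigits a l 0 (s₀ + r * t) (t / a ^ l) ×ˢ
      zeroDigits a l r (s₀ + r * t) (t % a ^ l)

theorem measurableSet_badSet (a l r s₀ : ℕ) : MeasurableSet (badSet a l r s₀) := by
  refine (measurableSet_unitSquare.diff (measurableSet_Ico.prod measurableSet_Ico)).union ?_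
  refine Finset.measurableSet_biUnion _ fun t _ => ?_
  exact ((measurableSet_zeroDigits ..).prod (measurableSet_zeroDigits ..)).union
    ((measurableSet_zeroDigits ..).prod (measurableSet_zeroDigits ..))

theorem volume_badSet_le {a : ℕ} (ha : 2 ≤ a) {l s₀ : ℕ} (r : ℕ) (hls : l ≤ s₀) :
    volume (badSet a l r s₀) ≤ ENNReal.ofReal (2 * ((a : ℝ) ^ r)⁻¹) := by
  have hside : volume (unitSquare \ Set.Ico (0 : ℝ) 1 ×ˢ Set.Ico (0 : ℝ) 1) = 0 := by
    have hsub : Set.Ico (0 : ℝ) 1 ×ˢ Set.Ico (0 : ℝ) 1 ⊆ unitSquare :=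
      Set.prod_mono Set.Ico_subset_Icc_self Set.Ico_subset_Icc_self
    rw [measure_sdiff hsub
      (measurableSet_Ico.prod measurableSet_Ico).nullMeasurableSet, volume_unitSquare,
      Measure.volume_eq_prod, Measure.prod_prod]
    · simp
    · rw [Measure.volume_eq_prod, Measure.prod_prod]
      simp
  have hblock : ∀ t ∈ Finset.range (a ^ l * a ^ l),
      volume (zeroDigits a l r (s₀ + r * t) (t / a ^ l) ×ˢ
        zeroDigits a l 0 (s₀ + r * t) (t % a ^ l) ∪
      zeroDigits a l 0 (s₀ + r * t) (t / a ^ l) ×ˢ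
        zeroDigits a l r (s₀ + r * t) (t % a ^ l))
      ≤ ENNReal.ofReal (2 * ((a : ℝ) ^ r)⁻¹ * (((a : ℝ) ^ l)⁻¹ * ((a : ℝ) ^ l)⁻¹)) := by
    intro t ht
    have ht' := Finset.mem_range.mp ht
    have hs : l ≤ s₀ + r * t := by omega
    have hd : t / a ^ l < a ^ l := Nat.div_lt_of_lt_mul ht'
    have hm : t % a ^ l < a ^ l := Nat.mod_lt _ (by positivity)
    refine (measure_union_le _ _).trans ?_
    rw [Measure.volume_eq_prod, Measure.prod_prod, Measure.prod_prod,
      volume_zeroDigits ha r hs hd, volume_zeroDigits ha 0 hs hm,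
      volume_zeroDigits ha 0 hs hd, volume_zeroDigits ha r hs hm,
      ← ENNReal.ofReal_mul (by positivity), ← ENNReal.ofReal_mul (by positivity),
      ← ENNReal.ofReal_add (by positivity) (by positivity)]
    refine ENNReal.ofReal_le_ofReal (le_of_eq ?_)
    ring
  refine (measure_union_le _ _).trans ?_
  rw [hside, zero_add]
  refine (measure_biUnion_finset_le _ _).trans ((Finset.sum_le_sum hblock).trans ?_)
  rw [Finset.sum_const, Finset.card_range, nsmul_eq_mul, ← ENNReal.ofReal_natCast,
    ← ENNReal.ofReal_mul (by positivity)]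
  refine ENNReal.ofReal_le_ofReal (le_of_eq ?_)
  push_cast
  field_simp

theorem not_mem_zeroDigits_of_not_mem_badSet {a : ℕ} (ha : 2 ≤ a) {l r s₀ : ℕ} {p : ℝ × ℝ}
    (hp : p ∈ unitSquare) (hpb : p ∉ badSet a l r s₀) {t : ℕ} (ht : t = cellIndex a l p) :
    p.1 ∉ zeroDigits a l r (s₀ + r * t) (t / a ^ l) ∧
      p.2 ∉ zeroDigits a l r (s₀ + r * t) (t % a ^ l) := by
  subst ht
  have hmem := Finset.mem_range.mpr (cellIndex_lt ha l p)
  simp only [badSet, Set.mem_union, Set.mem_iUnion, not_or, not_exists] at hpb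
  have h := hpb.2 _ hmem
  constructor
  · intro h1
    exact h.1 ⟨h1, hp.2, (cellIndex_mod ha l p).symm, cell_level_zero _ _⟩
  · intro h2
    exact h.2 ⟨⟨hp.1, (cellIndex_div ha l p).symm, cell_level_zero _ _⟩, h2⟩

/-- On the good set, the sum of the first `τ` complete blocks is the step function with values
`γ`, cut off after the first `τ` cells. -/
theorem sum_map_polyList_walshTerm {a l r s₀ : ℕ} (ha : 2 ≤ a) (hls : l ≤ s₀) (γ : ℕ → ℂ)
    {τ : ℕ} (hτ : τ ≤ a ^ l * a ^ l) {p : ℝ × ℝ} (hp : p ∈ unitSquare)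
    (hpb : p ∉ badSet a l r s₀) :
    ((polyList a l r s₀ τ).map fun i =>
        walshTerm a (polyCoeff a l r s₀ γ (a ^ l * a ^ l)) i p).sum
      = if cellIndex a l p < τ then γ (cellIndex a l p) else 0 := by
  rw [sum_map_polyList]
  have : ∀ t ∈ Finset.range τ, ∑ i ∈ blockIndex a l r (s₀ + r * t),
      walshTerm a (polyCoeff a l r s₀ γ (a ^ l * a ^ l)) i p
      = if cellIndex a l p = t then γ t else 0 := by
    intro t ht
    have ht' : t < a ^ l * a ^ l := (Finset.mem_range.mp ht).trans_le hτ
    rw [← sum_block ha (by omega : l ≤ s₀ + r * t) ht' (γ t) hp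
      (not_mem_zeroDigits_of_not_mem_badSet ha hp hpb)]
    refine Finset.sum_congr rfl fun i hi => ?_
    rw [walshTerm, polyCoeff_eq ha hls γ ht' hi, walshTerm]
  rw [Finset.sum_congr rfl this, Finset.sum_ite_eq]
  simp

/-! ### Polynomials imitating a continuous function -/

theorem measurable_sum_map_walshTerm (a : ℕ) (c : ℕ+ × ℕ+ → ℂ) (L : List (ℕ+ × ℕ+)) :
    Measurable fun p => (L.map fun i => walshTerm a c i p).sum := by
  induction L with
  | nil => simp
  | cons i L ih =>
    simp only [List.map_cons, List.sum_cons]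
    exact (measurable_walshTerm a c i).add ih

theorem exists_level {a : ℕ} (ha : 2 ≤ a) (r : ℕ) {ε δ η G : ℝ} (hε : 0 < ε) (hδ : 0 < δ)
    (hη : 0 < η) :
    ∃ l : ℕ, ((a : ℝ) ^ l)⁻¹ < η ∧ G * (a : ℝ) ^ r * ((a : ℝ) ^ l)⁻¹ ≤ δ ∧
      G * (((a : ℝ) ^ l)⁻¹) ^ 2 ≤ 1 ∧
      G ^ 2 * ((a : ℝ) ^ r) ^ 2 * (G * (((a : ℝ) ^ l)⁻¹) ^ 2) ^ ε ≤ ε := by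
  have ha1 : (1 : ℝ) < a := by exact_mod_cast (by omega : 1 < a)
  have hu : Tendsto (fun l : ℕ => ((a : ℝ) ^ l)⁻¹) atTop (𝓝 0) :=
    (tendsto_pow_atTop_atTop_of_one_lt ha1).inv_tendsto_atTop
  have h1 : Tendsto (fun l : ℕ => G * (a : ℝ) ^ r * ((a : ℝ) ^ l)⁻¹) atTop (𝓝 0) := by
    simpa using hu.const_mul (G * (a : ℝ) ^ r)
  have h2 : Tendsto (fun l : ℕ => G * (((a : ℝ) ^ l)⁻¹) ^ 2) atTop (𝓝 0) := by
    simpa using (hu.pow 2).const_mul G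
  have h3 : Tendsto (fun l : ℕ => G ^ 2 * ((a : ℝ) ^ r) ^ 2 * (G * (((a : ℝ) ^ l)⁻¹) ^ 2) ^ ε)
      atTop (𝓝 0) := by
    have := (h2.rpow_const (Or.inr hε.le)).const_mul (G ^ 2 * ((a : ℝ) ^ r) ^ 2)
    simpa [Real.zero_rpow hε.ne'] using this
  obtain ⟨l, hl⟩ := ((hu.eventually_lt_const hη).and ((h1.eventually_lt_const hδ).and
    ((h2.eventually_lt_const one_pos).and (h3.eventually_lt_const hε)))).exists
  exact ⟨l, hl.1, hl.2.1.le, hl.2.2.1.le, hl.2.2.2.le⟩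

/-- A continuous function `g` on the square is imitated by a Walsh polynomial with frequencies in
a prescribed range, small coefficients in the sense of `ℓ^(2 + ε)`, which is uniformly close to
`g` off a set of measure at most `ε`, and whose partial sums in a suitable order are no larger
than `g`, up to `ε`, in every weighted `L¹` norm off that set. -/
theorem exists_walsh_polynomial {a : ℕ} (ha : 2 ≤ a) {g : ℝ × ℝ → ℂ}
    (hg : ContinuousOn g unitSquare) {ε : ℝ} (hε : 0 < ε) (N : ℕ) :
    ∃ (L : List (ℕ+ × ℕ+)) (c : ℕ+ × ℕ+ → ℂ) (E : Set (ℝ × ℝ)) (N' : ℕ),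
      L.Nodup ∧ (∀ i ∈ L, N ≤ (i.1 : ℕ) ∧ (i.1 : ℕ) < N') ∧ (∀ i ∉ L, c i = 0) ∧
      (∀ i, ‖c i‖ ≤ 1) ∧ ∑ i ∈ L.toFinset, ‖c i‖ ^ (2 + ε) ≤ ε ∧
      MeasurableSet E ∧ E ⊆ unitSquare ∧ volume (unitSquare \ E) ≤ ENNReal.ofReal ε ∧
      (∀ p ∈ E, ‖(L.map fun i => walshTerm a c i p).sum - g p‖ ≤ ε) ∧
      ∀ L', L' <+: L → ∀ w : ℝ × ℝ → ℝ≥0∞, (∀ p ∈ unitSquare, w p ≤ 1) →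
        ∫⁻ p in E, ‖(L'.map fun i => walshTerm a c i p).sum‖ₑ * w p
          ≤ (∫⁻ p in E, ‖g p‖ₑ * w p) + ENNReal.ofReal ε := by
  have ha1 : (1 : ℝ) < a := by exact_mod_cast (by omega : 1 < a)
  obtain ⟨G, hG0, hG⟩ : ∃ G : ℝ, 0 < G ∧ ∀ p ∈ unitSquare, ‖g p‖ ≤ G := by
    obtain ⟨C, hC⟩ := isCompact_unitSquare.exists_bound_of_continuousOn hg
    exact ⟨max C 1, by positivity, fun p hp => (hC p hp).trans (le_max_left _ _)⟩
  obtain ⟨r, hr⟩ : ∃ r : ℕ, 2 * ((a : ℝ) ^ r)⁻¹ ≤ ε := by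
    have : Tendsto (fun r : ℕ => 2 * ((a : ℝ) ^ r)⁻¹) atTop (𝓝 0) := by
      simpa using (tendsto_pow_atTop_atTop_of_one_lt ha1).inv_tendsto_atTop.const_mul (2 : ℝ)
    obtain ⟨r, hr⟩ := (this.eventually_lt_const hε).exists
    exact ⟨r, hr.le⟩
  set δ := ε / 2 with hδ
  have hδ0 : 0 < δ := by positivity
  obtain ⟨η, hη, hosc⟩ := Metric.uniformContinuousOn_iff.mp
    (isCompact_unitSquare.uniformContinuousOn_of_continuous hg) δ hδ0
  obtain ⟨l, hl1, hl2, hl3, hl4⟩ := exists_level ha r (G := G) hε hδ0 hη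
  set M := a ^ l * a ^ l with hMdef
  set s₀ := l + N with hs₀
  have hls : l ≤ s₀ := by omega
  set γ : ℕ → ℂ := fun t => g (corner a l t) with hγ
  have hγG : ∀ t < M, ‖γ t‖ ≤ G := fun t ht => hG _ (corner_mem ha ht)
  set c := polyCoeff a l r s₀ γ M with hc
  set L := polyList a l r s₀ M with hL
  have hLnd : L.Nodup := nodup_polyList ha hls M
  have hcout : ∀ i ∉ L, c i = 0 := fun i hi =>
    polyCoeff_eq_zero γ fun t ht h => hi (mem_polyList.mpr ⟨t, ht, h⟩)
  have hcle : ∀ i, ‖c i‖ ≤ G * (((a : ℝ) ^ l)⁻¹) ^ 2 := by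
    intro i
    by_cases hi : i ∈ L
    · obtain ⟨t, ht, hit⟩ := mem_polyList.mp hi
      rw [hc, polyCoeff_eq ha hls γ ht hit, norm_blockCoeff ha]
      exact mul_le_mul_of_nonneg_right (hγG t ht) (by positivity)
    · rw [hcout i hi, norm_zero]
      positivity
  set E := unitSquare \ badSet a l r s₀ with hE
  -- On the good set the step function is close to `g`.
  have hstep : ∀ p ∈ E, ‖γ (cellIndex a l p) - g p‖ ≤ δ := by
    intro p hp
    have hp' : p ∈ Set.Ico (0 : ℝ) 1 ×ˢ Set.Ico (0 : ℝ) 1 := by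
      by_contra h
      exact hp.2 (Or.inl ⟨hp.1, h⟩)
    have h1 := hosc _ (corner_mem ha (cellIndex_lt ha l p)) p hp.1
      (by rw [dist_comm]; exact (dist_corner_le ha l hp').trans_lt hl1)
    rw [dist_eq_norm] at h1
    exact h1.le
  refine ⟨L, c, E, a ^ (s₀ + r * M), hLnd, ?_, hcout, fun i => (hcle i).trans hl3, ?_,
    measurableSet_unitSquare.diff (measurableSet_badSet ..), Set.sdiff_subset, ?_, ?_, ?_⟩
  · intro i hi
    obtain ⟨t, ht, hit⟩ := mem_polyList.mp hi
    obtain ⟨h1, h2⟩ := mem_blockIndex_bounds ha (by omega) hit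
    constructor
    · have h3 : s₀ + r * t < a ^ (s₀ + r * t) := Nat.lt_pow_self (by omega)
      omega
    · refine h2.trans_le (Nat.pow_le_pow_right (by omega) ?_)
      have : r * (t + 1) ≤ r * M := Nat.mul_le_mul_left _ ht
      linarith [Nat.mul_succ r t]
  · have hcard : (L.toFinset.card : ℝ) ≤ M * ((a : ℝ) ^ l * (a : ℝ) ^ r) ^ 2 := by
      rw [List.toFinset_card_of_nodup hLnd]
      exact length_polyList_le a l r s₀ M
    have hq : (0 : ℝ) < G * (((a : ℝ) ^ l)⁻¹) ^ 2 := by positivity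
    calc ∑ i ∈ L.toFinset, ‖c i‖ ^ (2 + ε)
        ≤ ∑ _i ∈ L.toFinset, (G * (((a : ℝ) ^ l)⁻¹) ^ 2) ^ (2 + ε) :=
          Finset.sum_le_sum fun i _ =>
            Real.rpow_le_rpow (norm_nonneg _) (hcle i) (by positivity)
      _ = L.toFinset.card * (G * (((a : ℝ) ^ l)⁻¹) ^ 2) ^ (2 + ε) := by
          rw [Finset.sum_const, nsmul_eq_mul]
      _ ≤ (M * ((a : ℝ) ^ l * (a : ℝ) ^ r) ^ 2) * (G * (((a : ℝ) ^ l)⁻¹) ^ 2) ^ (2 + ε) := by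
          gcongr
      _ = G ^ 2 * ((a : ℝ) ^ r) ^ 2 * (G * (((a : ℝ) ^ l)⁻¹) ^ 2) ^ ε := by
          rw [Real.rpow_add hq, Real.rpow_two, hMdef]
          push_cast
          field_simp
      _ ≤ ε := hl4
  · rw [hE, Set.sdiff_sdiff_right_self]
    exact (measure_mono Set.inter_subset_right).trans ((volume_badSet_le ha r hls).trans
      (ENNReal.ofReal_le_ofReal hr))
  · intro p hp
    rw [hL, sum_map_polyList_walshTerm ha hls γ le_rfl hp.1 hp.2,
      if_pos (cellIndex_lt ha l p)]
    exact (hstep p hp).trans (by linarith)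
  · intro L' hL' w hw
    obtain ⟨τ, hτ, L'', rfl, hL''⟩ := prefix_flatMap_range _ _ _ hL'
    -- The part of one block is small in `L²`, since it lives on a single cell.
    have hpart : ∫⁻ p in unitSquare, ‖(L''.map fun i => walshTerm a c i p).sum‖ₑ
        ≤ ENNReal.ofReal δ := by
      rcases hL'' with rfl | ⟨hτM, hpre⟩
      · simp
      · have hnd : L''.Nodup := hpre.sublist.nodup (Finset.nodup_toList _)
        simp only [← List.sum_toFinset _ hnd]
        refine lintegral_sum_walshTerm_le ha c _ hδ0 ?_
        have hcard : (L''.toFinset.card : ℝ) ≤ ((a : ℝ) ^ l * (a : ℝ) ^ r) ^ 2 := by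
          refine le_trans ?_ (card_blockIndex a l r (s₀ + r * τ))
          rw [List.toFinset_card_of_nodup hnd, ← Finset.length_toList]
          exact_mod_cast hpre.length_le
        calc ∑ i ∈ L''.toFinset, ‖c i‖ ^ 2
            ≤ ∑ _i ∈ L''.toFinset, (G * (((a : ℝ) ^ l)⁻¹) ^ 2) ^ 2 :=
              Finset.sum_le_sum fun i _ => pow_le_pow_left₀ (norm_nonneg _) (hcle i) 2
          _ = L''.toFinset.card * (G * (((a : ℝ) ^ l)⁻¹) ^ 2) ^ 2 := by
              rw [Finset.sum_const, nsmul_eq_mul]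
          _ ≤ ((a : ℝ) ^ l * (a : ℝ) ^ r) ^ 2 * (G * (((a : ℝ) ^ l)⁻¹) ^ 2) ^ 2 := by
              gcongr
          _ = (G * (a : ℝ) ^ r * ((a : ℝ) ^ l)⁻¹) ^ 2 := by field_simp
          _ ≤ δ ^ 2 := pow_le_pow_left₀ (by positivity) hl2 2
    have hEm : MeasurableSet E := measurableSet_unitSquare.diff (measurableSet_badSet ..)
    have hpoint : ∀ p ∈ E,
        ‖((((List.range τ).flatMap fun t => (blockIndex a l r (s₀ + r * t)).toList) ++ L'').map
          fun i => walshTerm a c i p).sum‖ₑ * w p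
        ≤ ‖g p‖ₑ * w p
          + (ENNReal.ofReal δ + ‖(L''.map fun i => walshTerm a c i p).sum‖ₑ) := by
      intro p hp
      have hfull : ‖((polyList a l r s₀ τ).map fun i => walshTerm a c i p).sum‖ₑ
          ≤ ‖g p‖ₑ + ENNReal.ofReal δ := by
        rw [sum_map_polyList_walshTerm ha hls γ hτ hp.1 hp.2]
        split_ifs
        · have h1 : ‖γ (cellIndex a l p)‖ ≤ ‖g p‖ + δ := by
            have := norm_le_norm_add_norm_sub (g p) (γ (cellIndex a l p))
            rw [norm_sub_rev] at this
            exact this.trans (by gcongr; exact hstep p hp)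
          rw [← ofReal_norm, ← ofReal_norm,
            ← ENNReal.ofReal_add (norm_nonneg _) hδ0.le]
          exact ENNReal.ofReal_le_ofReal h1
        · simp
      have hw1 : ∀ x : ℝ≥0∞, x * w p ≤ x := fun x =>
        (mul_le_mul_right (hw p hp.1) x).trans (mul_one x).le
      rw [List.map_append, List.sum_append]
      refine (mul_le_mul_left (enorm_add_le _ _) _).trans ?_
      rw [add_mul]
      refine (add_le_add (mul_le_mul_left hfull _) (hw1 _)).trans ?_
      rw [add_mul, add_assoc]
      gcongr
      exact hw1 _
    refine (setLIntegral_mono' hEm hpoint).trans ?_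
    have hm : Measurable fun p => ‖(L''.map fun i => walshTerm a c i p).sum‖ₑ :=
      (measurable_sum_map_walshTerm a c L'').enorm
    rw [lintegral_add_right _ (by fun_prop), lintegral_add_right _ hm, setLIntegral_const]
    have hε2 : ENNReal.ofReal ε = ENNReal.ofReal δ + ENNReal.ofReal δ := by
      rw [← ENNReal.ofReal_add hδ0.le hδ0.le, hδ, add_halves]
    rw [hε2]
    gcongr
    · refine (mul_le_mul_right
        ((measure_mono Set.sdiff_subset).trans volume_unitSquare.le) _).trans ?_
      rw [mul_one]
    · exact (lintegral_mono_set Set.sdiff_subset).trans hpart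

/-! ### Rearranging a series so that it converges to a given sum -/

section Rearrangement

variable {ι X : Type*} [NormedAddCommGroup X]

/-- One step of the rearrangement: the list `U` of terms used so far is extended by a given index
`i` and by a block that nearly cancels the remaining error. -/
theorem exists_list_extension {F : ι → X} {A : Set ι} {L : ℕ → List ι}
    (hnd : ∀ m, (L m).Nodup) (hsub : ∀ m, ∀ i ∈ L m, i ∈ A)
    (havoid : ∀ U : List ι, ∀ᶠ m in atTop, ∀ i ∈ L m, i ∉ U) {g : ℕ → X} {η : ℕ → ℝ}
    (hη : Tendsto η atTop (𝓝 0))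
    (hpre : ∀ m L', L' <+: L m → ‖(L'.map F).sum‖ ≤ ‖g m‖ + η m)
    (hfull : ∀ m, ‖((L m).map F).sum - g m‖ ≤ η m)
    (hdense : ∀ v, ∀ δ > 0, ∃ᶠ m in atTop, ‖g m - v‖ < δ) (f : X)
    {U : List ι} (hU : U.Nodup) (hUA : ∀ i ∈ U, i ∈ A) {i : ι} (hi : i ∈ A) {δ : ℝ}
    (hδ : 0 < δ) :
    ∃ V : List ι, U <+: V ∧ V.Nodup ∧ (∀ i ∈ V, i ∈ A) ∧ i ∈ V ∧
      ‖f - (V.map F).sum‖ ≤ δ ∧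
      ∀ W, U <+: W → W <+: V →
        ‖f - (W.map F).sum‖ ≤ 2 * (‖f - (U.map F).sum‖ + ‖F i‖) + δ := by
  classical
  -- `K` is `[i]`, or empty when `i` has been used before.
  obtain ⟨K, hKnd, hKA, hiK, hKF⟩ : ∃ K : List ι, (U ++ K).Nodup ∧ (∀ j ∈ K, j ∈ A) ∧
      i ∈ U ++ K ∧ ∀ W, W <+: K → ‖(W.map F).sum‖ ≤ ‖F i‖ := by
    by_cases h : i ∈ U
    · refine ⟨[], by simpa using hU, by simp, by simpa using h, fun W hW => ?_⟩
      rw [List.prefix_nil.mp hW]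
      simp
    · refine ⟨[i], ?_, by simpa using hi, by simp, fun W hW => ?_⟩
      · rw [List.nodup_append]
        refine ⟨hU, List.nodup_singleton i, fun x hx y hy => ?_⟩
        rw [List.mem_singleton.mp hy]
        rintro rfl
        exact h hx
      · rcases List.prefix_cons_iff.mp hW with rfl | ⟨t, rfl, ht⟩
        · simp
        · rw [List.prefix_nil.mp ht]
          simp
  obtain ⟨m, hm1, hm2, hm3⟩ :=
    ((hdense (f - ((U ++ K).map F).sum) (δ / 2) (by positivity)).and_eventually
      ((havoid (U ++ K)).and (hη.eventually_lt_const (half_pos hδ)))).exists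
  have hK0 : ‖f - ((U ++ K).map F).sum‖ ≤ ‖f - (U.map F).sum‖ + ‖F i‖ := by
    rw [List.map_append, List.sum_append, ← sub_sub]
    exact (norm_sub_le _ _).trans (by gcongr; exact hKF K List.prefix_rfl)
  refine ⟨U ++ K ++ L m, ⟨K ++ L m, by simp⟩, ?_, ?_, ?_, ?_, ?_⟩
  · rw [List.nodup_append]
    refine ⟨hKnd, hnd m, fun x hx y hy => ?_⟩
    rintro rfl
    exact hm2 x hy hx
  · intro j hj
    simp only [List.mem_append] at hj
    rcases hj with (hj | hj) | hj
    · exact hUA j hj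
    · exact hKA j hj
    · exact hsub m j hj
  · exact List.mem_append_left _ hiK
  · have e : f - ((U ++ K ++ L m).map F).sum
        = -(g m - (f - ((U ++ K).map F).sum)) - (((L m).map F).sum - g m) := by
      rw [List.map_append (l₁ := U ++ K), List.sum_append]
      abel
    rw [e]
    refine (norm_sub_le _ _).trans ?_
    rw [norm_neg]
    linarith [hfull m]
  · rintro W ⟨W', rfl⟩ hW
    rw [List.append_assoc, List.prefix_append_right_inj] at hW
    rcases prefix_append_cases hW with hW | ⟨L', rfl, hL'⟩
    · rw [List.map_append, List.sum_append, ← sub_sub]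
      refine (norm_sub_le _ _).trans ?_
      have := hKF W' hW
      have := norm_nonneg (f - (U.map F).sum)
      linarith [norm_nonneg (F i)]
    · have h1 := hpre m L' hL'
      have h2 : ‖g m‖ ≤ ‖f - ((U ++ K).map F).sum‖ + δ / 2 := by
        have := norm_le_norm_add_norm_sub (f - ((U ++ K).map F).sum) (g m)
        rw [norm_sub_rev _ (g m)] at this
        linarith
      rw [← List.append_assoc, List.map_append (l₁ := U ++ K), List.sum_append, ← sub_sub]
      refine (norm_sub_le _ _).trans ?_
      linarith

/-- If the terms of a series tend to zero, and there are finite blocks of terms, arbitrarily far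
out, whose sums are dense and whose partial sums are dominated by the complete sum, then the
series can be rearranged to converge to any prescribed sum: alternately append the next unused
term and a block that nearly corrects the remaining error. -/
theorem exists_enumeration_tendsto [Countable ι] {F : ι → X}
    (hF : Tendsto (fun i => ‖F i‖) cofinite (𝓝 0)) {A : Set ι} (hA : A.Infinite)
    {L : ℕ → List ι}
    (hnd : ∀ m, (L m).Nodup) (hsub : ∀ m, ∀ i ∈ L m, i ∈ A)
    (havoid : ∀ U : List ι, ∀ᶠ m in atTop, ∀ i ∈ L m, i ∉ U) {g : ℕ → X} {η : ℕ → ℝ}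
    (hη : Tendsto η atTop (𝓝 0))
    (hpre : ∀ m L', L' <+: L m → ‖(L'.map F).sum‖ ≤ ‖g m‖ + η m)
    (hfull : ∀ m, ‖((L m).map F).sum - g m‖ ≤ η m)
    (hdense : ∀ v, ∀ δ > 0, ∃ᶠ m in atTop, ‖g m - v‖ < δ) (f : X) :
    ∃ e : ℕ ≃ A, Tendsto (fun n => ∑ k ∈ Finset.range n, F (e k)) atTop (𝓝 f) := by
  have : Infinite A := hA.to_subtype
  obtain ⟨en⟩ : Nonempty (ℕ ≃ A) := nonempty_equiv_of_countable
  have step : ∀ (j : ℕ) (U : {U : List ι // U.Nodup ∧ ∀ i ∈ U, i ∈ A}),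
      ∃ V : {U : List ι // U.Nodup ∧ ∀ i ∈ U, i ∈ A}, U.1 <+: V.1 ∧ (en j : ι) ∈ V.1 ∧
        ‖f - (V.1.map F).sum‖ ≤ (1 / 2 : ℝ) ^ j ∧
        ∀ W, U.1 <+: W → W <+: V.1 → ‖f - (W.map F).sum‖
          ≤ 2 * (‖f - (U.1.map F).sum‖ + ‖F (en j)‖) + (1 / 2 : ℝ) ^ j := by
    intro j U
    obtain ⟨V, h1, h2, h3, h4, h5, h6⟩ := exists_list_extension hnd hsub havoid hη hpre hfull
      hdense f U.2.1 U.2.2 (en j).2 (by positivity : (0 : ℝ) < (1 / 2) ^ j)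
    exact ⟨⟨V, h2, h3⟩, h1, h4, h5, h6⟩
  choose next hn1 hn2 hn3 hn4 using step
  let U : ℕ → {U : List ι // U.Nodup ∧ ∀ i ∈ U, i ∈ A} :=
    fun j => Nat.rec ⟨[], List.nodup_nil, by simp⟩ (fun j V => next j V) j
  have hU0 : (U 0).1 = [] := rfl
  have hUs : ∀ j, U (j + 1) = next j (U j) := fun _ => rfl
  have hmono : ∀ {j j'}, j ≤ j' → (U j).1 <+: (U j').1 := by
    intro j j' h
    induction h with
    | refl => exact List.prefix_rfl
    | step _ ih => exact ih.trans (hn1 _ _)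
  have hlen : ∀ j, j ≤ (U j).1.length := by
    intro j
    classical
    have hsub : (Finset.range j).image (fun k => (en k : ι)) ⊆ (U j).1.toFinset := by
      intro x hx
      obtain ⟨k, hk, rfl⟩ := Finset.mem_image.mp hx
      rw [List.mem_toFinset]
      exact (hmono (Finset.mem_range.mp hk)).subset (hn2 k (U k))
    have hcard := Finset.card_le_card hsub
    rw [Finset.card_image_of_injective (f := fun k => (en k : ι)) _
      (Subtype.val_injective.comp en.injective), Finset.card_range] at hcard
    exact hcard.trans (List.toFinset_card_le _)
  let e : ℕ → ι := fun k => (U (k + 1)).1[k]'(hlen (k + 1))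
  have he : ∀ j k (hk : k < (U j).1.length), (U j).1[k] = e k := by
    intro j k hk
    rcases le_total j (k + 1) with h | h
    · exact (hmono h).getElem hk
    · exact ((hmono h).getElem (hlen (k + 1))).symm
  have hinj : Function.Injective e := by
    intro k k' h
    have hk : k < (U (k + k' + 1)).1.length := by have := hlen (k + k' + 1); omega
    have hk' : k' < (U (k + k' + 1)).1.length := by have := hlen (k + k' + 1); omega
    rw [← he (k + k' + 1) k hk, ← he (k + k' + 1) k' hk'] at h
    exact (List.Nodup.getElem_inj_iff (U (k + k' + 1)).2.1).mp h
  have hrange : Set.range e = A := by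
    ext i
    constructor
    · rintro ⟨k, rfl⟩
      exact (U (k + 1)).2.2 _ (List.getElem_mem _)
    · intro hi
      have : i ∈ (U (en.symm ⟨i, hi⟩ + 1)).1 := by
        have := hn2 (en.symm ⟨i, hi⟩) (U (en.symm ⟨i, hi⟩))
        rwa [Equiv.apply_symm_apply] at this
      obtain ⟨k, hk, hki⟩ := List.getElem_of_mem this
      exact ⟨k, (he (en.symm ⟨i, hi⟩ + 1) k hk).symm.trans hki⟩
  have hsum : ∀ j n, n ≤ (U j).1.length →
      ∑ k ∈ Finset.range n, F (e k) = (((U j).1.take n).map F).sum := by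
    intro j n
    induction n with
    | zero => simp
    | succ n ih =>
      intro hn
      rw [Finset.sum_range_succ, ih (by omega), ← List.take_append_getElem (by omega),
        List.map_append, List.sum_append, he j n (by omega)]
      simp
  have hb : Tendsto (fun j => 2 * (‖f - ((U j).1.map F).sum‖ + ‖F (en j)‖) + (1 / 2 : ℝ) ^ j)
      atTop (𝓝 0) := by
    have hp : Tendsto (fun j : ℕ => (1 / 2 : ℝ) ^ j) atTop (𝓝 0) :=
      tendsto_pow_atTop_nhds_zero_of_lt_one (by norm_num) (by norm_num)
    have h1 : Tendsto (fun j => ‖f - ((U j).1.map F).sum‖) atTop (𝓝 0) := by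
      rw [← tendsto_add_atTop_iff_nat 1]
      exact squeeze_zero (fun _ => norm_nonneg _) (fun j => hn3 j (U j)) hp
    have h2 : Tendsto (fun j => ‖F (en j)‖) atTop (𝓝 0) := by
      rw [← Nat.cofinite_eq_atTop]
      exact hF.comp (Subtype.val_injective.comp en.injective).tendsto_cofinite
    simpa using ((h1.add h2).const_mul 2).add hp
  refine ⟨(Equiv.ofInjective e hinj).trans (Equiv.setCongr hrange), ?_⟩
  change Tendsto (fun n => ∑ k ∈ Finset.range n, F (e k)) atTop (𝓝 f)
  rw [Metric.tendsto_atTop]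
  intro ε hε
  obtain ⟨J, hJ⟩ := eventually_atTop.mp (hb.eventually_lt_const hε)
  refine ⟨(U J).1.length, fun n hn => ?_⟩
  have hex : ∃ j, n < (U (j + 1)).1.length := ⟨n, hlen (n + 1)⟩
  classical
  have hlt := Nat.find_spec hex
  set j := Nat.find hex with hj
  have hle : (U j).1.length ≤ n := by
    rcases Nat.eq_zero_or_pos j with h | h
    · rw [h, hU0]
      exact Nat.zero_le _
    · have := Nat.find_min hex (m := j - 1) (by omega)
      rw [Nat.sub_add_cancel h] at this
      exact not_lt.mp this
  have hJj : J ≤ j := by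
    by_contra h
    have := (hmono (by omega : j + 1 ≤ J)).length_le
    omega
  rw [dist_comm, dist_eq_norm, hsum (j + 1) n hlt.le]
  refine (hn4 j (U j) _ ?_ (List.take_prefix _ _)).trans_lt (hJ j hJj)
  exact List.prefix_of_prefix_length_le (hn1 j (U j)) (List.take_prefix _ _)
    (by rw [List.length_take]; exact le_min hle (hn1 j (U j)).length_le)

end Rearrangement

/-! ### The weight -/

/-- Given exceptional sets of summable measure and bounds `B m`, there is a weight, equal to one
off a set of small measure, that outweighs `B m` on the `m`-th exceptional set for all large
`m`. -/
theorem exists_weight {S : ℕ → Set (ℝ × ℝ)} (hS : ∀ m, MeasurableSet (S m))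
    (hvol : ∀ m, volume (S m) ≤ ENNReal.ofReal ((1 / 2) ^ m)) (B : ℕ → ℝ) {ε : ℝ}
    (hε : 0 < ε) :
    ∃ (μ : ℝ × ℝ → ℝ) (m₀ : ℕ), IsWeight μ ∧
      volume {p | p ∈ unitSquare ∧ μ p ≠ 1} < ENNReal.ofReal ε ∧
      ∀ m ≥ m₀, ∀ᵐ p, p ∈ S m → B m * μ p ≤ (1 / 2) ^ m := by
  obtain ⟨m₀, hm₀⟩ : ∃ m₀ : ℕ, 2 * (1 / 2 : ℝ) ^ m₀ < ε := by
    have : Tendsto (fun m : ℕ => 2 * (1 / 2 : ℝ) ^ m) atTop (𝓝 0) := by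
      simpa using (tendsto_pow_atTop_nhds_zero_of_lt_one (r := (1 / 2 : ℝ)) (by norm_num)
        (by norm_num)).const_mul (2 : ℝ)
    exact (this.eventually_lt_const hε).exists
  have hgeom : ∑' m : ℕ, ENNReal.ofReal ((1 / 2 : ℝ) ^ (m + m₀))
      = ENNReal.ofReal (2 * (1 / 2 : ℝ) ^ m₀) := by
    have hs : HasSum (fun m : ℕ => (1 / 2 : ℝ) ^ (m + m₀)) (2 * (1 / 2 : ℝ) ^ m₀) := by
      simpa [pow_add] using hasSum_geometric_two.mul_right ((1 / 2 : ℝ) ^ m₀)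
    rw [← ENNReal.ofReal_tsum_of_nonneg (fun _ => by positivity) hs.summable, hs.tsum_eq]
  have htsum : ∑' m : ℕ, volume (S (m + m₀)) ≤ ENNReal.ofReal (2 * (1 / 2 : ℝ) ^ m₀) :=
    (ENNReal.tsum_le_tsum fun m => hvol (m + m₀)).trans hgeom.le
  let t : ℝ × ℝ → ℝ≥0∞ := fun p =>
    ∑' m : ℕ, (S (m + m₀)).indicator (fun _ => ENNReal.ofReal (2 ^ (m + m₀) * B (m + m₀))) p
  have ht : Measurable t :=
    Measurable.tsum fun m => measurable_const.indicator (hS (m + m₀))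
  -- Where the sum is infinite, `toReal` gives `0` and the weight is `1`; this set is null.
  refine ⟨fun p => (1 + (t p).toReal)⁻¹, m₀, ⟨?_, ?_, ?_⟩, ?_, ?_⟩
  · exact (measurable_const.add ht.ennreal_toReal).inv
  · intro p _
    positivity
  · intro p _
    exact inv_le_one_of_one_le₀ (by linarith [ENNReal.toReal_nonneg (a := t p)])
  · have hsub : {p | p ∈ unitSquare ∧ (1 + (t p).toReal)⁻¹ ≠ 1} ⊆ ⋃ m, S (m + m₀) := by
      rintro p ⟨_, hp⟩
      by_contra h
      simp only [Set.mem_iUnion, not_exists] at h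
      exact hp (by simp [t, h])
    refine (measure_mono hsub).trans_lt ((measure_iUnion_le _).trans_lt (htsum.trans_lt ?_))
    exact (ENNReal.ofReal_lt_ofReal_iff hε).mpr hm₀
  · intro m hm
    have hae := ae_eventually_notMem (μ := volume) (s := fun m => S (m + m₀))
      (htsum.trans_lt ENNReal.ofReal_lt_top).ne
    filter_upwards [hae] with p hp hpm
    obtain ⟨n, hn⟩ := eventually_atTop.mp hp
    have hfin : t p ≠ ⊤ := by
      have : t p = ∑ m ∈ Finset.range n,
          (S (m + m₀)).indicator (fun _ => ENNReal.ofReal (2 ^ (m + m₀) * B (m + m₀))) p :=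
        tsum_eq_sum fun m hm => by
          rw [Finset.mem_range, not_lt] at hm
          exact Set.indicator_of_notMem (hn m hm) _
      rw [this]
      refine (ENNReal.sum_lt_top.mpr fun m _ => ?_).ne
      exact (Set.indicator_le_self _ _ p).trans_lt ENNReal.ofReal_lt_top
    have hle : 2 ^ m * B m ≤ (t p).toReal := by
      refine (ENNReal.ofReal_le_iff_le_toReal hfin).mp ?_
      have := ENNReal.le_tsum (f := fun m : ℕ => (S (m + m₀)).indicator
        (fun _ => ENNReal.ofReal (2 ^ (m + m₀) * B (m + m₀))) p) (m - m₀)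
      simp only [Nat.sub_add_cancel hm, Set.indicator_of_mem hpm] at this
      exact this
    have h0 : 0 < 1 + (t p).toReal := by positivity
    rw [← div_eq_mul_inv, div_le_iff₀ h0, one_div, inv_pow, ← div_eq_inv_mul,
      le_div_iff₀ (by positivity), mul_comm]
    linarith

/-! ### The coefficients -/

/-- A sequence of continuous functions on the square in which every continuous function is
uniformly approximated infinitely often. -/
theorem exists_dense_seq_continuousOn :
    ∃ g : ℕ → ℝ × ℝ → ℂ, (∀ m, ContinuousOn (g m) unitSquare) ∧
      ∀ h : ℝ × ℝ → ℂ, ContinuousOn h unitSquare → ∀ δ > 0,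
        ∃ᶠ m in atTop, ∀ p ∈ unitSquare, ‖g m p - h p‖ < δ := by
  classical
  have : CompactSpace unitSquare := isCompact_iff_compactSpace.mp isCompact_unitSquare
  let d : ℕ → C(unitSquare, ℂ) := TopologicalSpace.denseSeq C(unitSquare, ℂ)
  let ext : C(unitSquare, ℂ) → ℝ × ℝ → ℂ := fun h p =>
    if hp : p ∈ unitSquare then h ⟨p, hp⟩ else 0
  have hext : ∀ h (p : unitSquare), ext h p = h p := fun h p => by simp [ext]
  refine ⟨fun m => ext (d m.unpair.1), fun m => ?_, fun h hh δ hδ => ?_⟩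
  · beta_reduce
    rw [continuousOn_iff_continuous_domRestrict]
    have : unitSquare.domRestrict (ext (d m.unpair.1)) = d m.unpair.1 := funext (hext _)
    rw [this]
    exact (d m.unpair.1).continuous
  · obtain ⟨k, hk⟩ := (TopologicalSpace.denseRange_denseSeq C(unitSquare, ℂ)).exists_dist_lt
      ⟨unitSquare.domRestrict h, continuousOn_iff_continuous_domRestrict.mp hh⟩ hδ
    rw [frequently_atTop]
    intro n
    refine ⟨Nat.pair k n, Nat.right_le_pair k n, fun p hp => ?_⟩
    beta_reduce
    rw [Nat.unpair_pair, hext (d k) ⟨p, hp⟩, ← dist_eq_norm, dist_comm]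
    exact (ContinuousMap.dist_apply_le_dist ⟨p, hp⟩).trans_lt hk

/-- The polynomials imitating the functions `g m` up to `2 ^ (-m)`, with frequency ranges chosen one
after the other so that the spectra are disjoint, are the blocks `L m` of one double series. No
index `(1, k)` belongs to a block. -/
theorem exists_coefficients {a : ℕ} (ha : 2 ≤ a) {g : ℕ → ℝ × ℝ → ℂ}
    (hg : ∀ m, ContinuousOn (g m) unitSquare) :
    ∃ (c : ℕ+ × ℕ+ → ℂ) (L : ℕ → List (ℕ+ × ℕ+)) (E : ℕ → Set (ℝ × ℝ)),
      (∀ i, i.1 = 1 → c i = 0) ∧ (∀ q : ℝ, 2 < q → Summable fun i => ‖c i‖ ^ q) ∧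
      (∀ m, (L m).Nodup) ∧ (∀ m, ∀ i ∈ L m, i.1 ≠ 1 ∧ m ≤ (i.1 : ℕ)) ∧
      (∀ m, MeasurableSet (E m)) ∧ (∀ m, E m ⊆ unitSquare) ∧
      (∀ m, volume (unitSquare \ E m) ≤ ENNReal.ofReal ((1 / 2) ^ m)) ∧
      (∀ m, ∀ p ∈ E m, ‖((L m).map fun i => walshTerm a c i p).sum - g m p‖ ≤ (1 / 2) ^ m) ∧
      ∀ m L', L' <+: L m → ∀ w : ℝ × ℝ → ℝ≥0∞, (∀ p ∈ unitSquare, w p ≤ 1) →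
        ∫⁻ p in E m, ‖(L'.map fun i => walshTerm a c i p).sum‖ₑ * w p
          ≤ (∫⁻ p in E m, ‖g m p‖ₑ * w p) + ENNReal.ofReal ((1 / 2) ^ m) := by
  classical
  have hε : ∀ m : ℕ, (0 : ℝ) < (1 / 2) ^ m := fun m => by positivity
  choose Lf cf Ef Nf h1 h2 h3 h4 h5 h6 h7 h8 h9 h10 using
    fun (m N : ℕ) => exists_walsh_polynomial ha (hg m) (hε m) N
  let Ns : ℕ → ℕ := fun m => Nat.rec 2 (fun m N => max (Nf m N) (N + 1)) m
  have hNs : ∀ m, Ns (m + 1) = max (Nf m (Ns m)) (Ns m + 1) := fun _ => rfl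
  have hNmono : StrictMono Ns := strictMono_nat_of_lt_succ fun m => by rw [hNs]; omega
  have hN2 : ∀ m, 2 ≤ Ns m := fun m => hNmono.monotone (Nat.zero_le m)
  set L : ℕ → List (ℕ+ × ℕ+) := fun m => Lf m (Ns m) with hL
  have hmem : ∀ m, ∀ i ∈ L m, 2 ≤ (i.1 : ℕ) ∧ m ≤ (i.1 : ℕ) := fun m i hi =>
    ⟨(hN2 m).trans (h2 m _ i hi).1, (hNmono.id_le m).trans (h2 m _ i hi).1⟩
  have hdisj : ∀ {m m' i}, i ∈ L m → i ∈ L m' → m = m' := by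
    have key : ∀ m m' i, i ∈ L m → i ∈ L m' → ¬ m < m' := by
      intro m m' i hi hi' hlt
      have e1 := (h2 m _ i hi).2
      have e2 := (h2 m' _ i hi').1
      have e3 : Ns (m + 1) ≤ Ns m' := hNmono.monotone hlt
      rw [hNs] at e3
      omega
    intro m m' i hi hi'
    exact le_antisymm (not_lt.mp (key _ _ i hi' hi)) (not_lt.mp (key _ _ i hi hi'))
  set c : ℕ+ × ℕ+ → ℂ := fun i => ∑ m ∈ Finset.range (i.1 + 1), cf m (Ns m) i with hc
  have hcL : ∀ {m i}, i ∈ L m → c i = cf m (Ns m) i := by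
    intro m i hi
    simp only [hc]
    rw [Finset.sum_eq_single m]
    · intro m' _ hne
      exact h3 m' _ i fun h => hne (hdisj h hi)
    · intro h
      exact absurd (Finset.mem_range.mpr (Nat.lt_succ_of_le (hmem m i hi).2)) h
  have hc0 : ∀ i, (∀ m, i ∉ L m) → c i = 0 := fun i hi =>
    Finset.sum_eq_zero fun m _ => h3 m _ i (hi m)
  have hterm : ∀ m (p : ℝ × ℝ) (L' : List (ℕ+ × ℕ+)), (∀ i ∈ L', i ∈ L m) →
      (L'.map fun i => walshTerm a c i p) = L'.map fun i => walshTerm a (cf m (Ns m)) i p := by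
    intro m p L' hL'
    refine List.map_congr_left fun i hi => ?_
    rw [walshTerm, hcL (hL' i hi), walshTerm]
  refine ⟨c, L, fun m => Ef m (Ns m), ?_, ?_, fun m => h1 m _, ?_, fun m => h6 m _,
    fun m => h7 m _, fun m => h8 m _, ?_, ?_⟩
  · intro i hi
    refine hc0 i fun m h => ?_
    have := (hmem m i h).1
    rw [hi] at this
    exact absurd this (by norm_num)
  · intro q hq
    set b : ℕ → ℝ := fun m => ∑ i ∈ (L m).toFinset, ‖c i‖ ^ q with hb
    have hb0 : ∀ m, 0 ≤ b m := fun m => Finset.sum_nonneg fun i _ => by positivity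
    have hbs : Summable b := by
      have hlim : Tendsto (fun m : ℕ => (1 / 2 : ℝ) ^ m) atTop (𝓝 0) :=
        tendsto_pow_atTop_nhds_zero_of_lt_one (by norm_num) (by norm_num)
      obtain ⟨K, hK⟩ := eventually_atTop.mp (hlim.eventually_lt_const (sub_pos.mpr hq))
      rw [← summable_nat_add_iff K]
      refine Summable.of_nonneg_of_le (fun m => hb0 _) (fun m => ?_)
        ((summable_nat_add_iff K).mpr summable_geometric_two)
      refine le_trans (Finset.sum_le_sum fun i hi => ?_) (h5 (m + K) (Ns (m + K)))
      rw [hcL (List.mem_toFinset.mp hi)]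
      have hle := h4 (m + K) (Ns (m + K)) i
      have hKm := hK (m + K) (by omega)
      exact Real.rpow_le_rpow_of_exponent_ge' (norm_nonneg _) hle (by positivity) (by linarith)
    refine summable_of_sum_le (c := ∑' m, b m) (fun i => by positivity) fun u => ?_
    obtain ⟨K, hK⟩ : ∃ K : ℕ, ∀ i ∈ u, (i.1 : ℕ) < K :=
      ⟨u.sup (fun i => (i.1 : ℕ)) + 1, fun i hi =>
        Nat.lt_succ_of_le (Finset.le_sup (f := fun i : ℕ+ × ℕ+ => (i.1 : ℕ)) hi)⟩
    calc ∑ i ∈ u, ‖c i‖ ^ q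
        ≤ ∑ i ∈ (Finset.range K).biUnion fun m => (L m).toFinset, ‖c i‖ ^ q := by
          rw [← Finset.sum_filter_ne_zero]
          refine Finset.sum_le_sum_of_subset_of_nonneg (fun i hi => ?_)
            fun i _ _ => by positivity
          obtain ⟨hi, hne⟩ := Finset.mem_filter.mp hi
          by_contra hnot
          refine hne ?_
          rw [hc0 i fun m hm => hnot ?_, norm_zero, Real.zero_rpow (by linarith)]
          rw [Finset.mem_biUnion]
          exact ⟨m, Finset.mem_range.mpr ((hmem m i hm).2.trans_lt (hK i hi)),
            List.mem_toFinset.mpr hm⟩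
      _ = ∑ m ∈ Finset.range K, b m := by
          refine Finset.sum_biUnion fun m _ m' _ hne => ?_
          rw [Function.onFun, Finset.disjoint_left]
          intro i hi hi'
          exact hne (hdisj (List.mem_toFinset.mp hi) (List.mem_toFinset.mp hi'))
      _ ≤ ∑' m, b m := hbs.sum_le_tsum _ fun m _ => hb0 m
  · intro m i hi
    refine ⟨?_, (hmem m i hi).2⟩
    rintro h
    have := (hmem m i hi).1
    rw [h] at this
    exact absurd this (by norm_num)
  · intro m p hp
    rw [hterm m p _ fun i hi => hi]
    exact h9 m _ p hp
  · intro m L' hL' w hw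
    have e : ∀ p, (L'.map fun i => walshTerm a c i p)
        = L'.map fun i => walshTerm a (cf m (Ns m)) i p :=
      fun p => hterm m p L' fun i hi => hL'.subset hi
    simp only [e]
    exact h10 m _ L' hL' w hw

/-! ### The weighted space -/

/-- The measure `μ dx dy` on the square. -/
noncomputable def weightedMeasure (μ : ℝ × ℝ → ℝ) : Measure (ℝ × ℝ) :=
  (volume.restrict unitSquare).withDensity fun p => ENNReal.ofReal (μ p)

theorem IsWeight.ofReal_le_one {μ : ℝ × ℝ → ℝ} (hμ : IsWeight μ) {p : ℝ × ℝ}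
    (hp : p ∈ unitSquare) : ENNReal.ofReal (μ p) ≤ 1 :=
  ENNReal.ofReal_le_one.mpr (hμ.le_one p hp)

theorem IsWeight.isFiniteMeasure {μ : ℝ × ℝ → ℝ} (hμ : IsWeight μ) :
    IsFiniteMeasure (weightedMeasure μ) := by
  refine isFiniteMeasure_withDensity ?_
  refine ((setLIntegral_mono' measurableSet_unitSquare
    fun p hp => hμ.ofReal_le_one hp).trans_lt ?_).ne
  rw [setLIntegral_one, volume_unitSquare]
  exact ENNReal.one_lt_top

theorem weightedNorm_eq_eLpNorm {μ : ℝ × ℝ → ℝ} (hμ : IsWeight μ) (h : ℝ × ℝ → ℂ) :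
    weightedNorm μ h = eLpNorm h 1 (weightedMeasure μ) := by
  rw [eLpNorm_one_eq_lintegral_enorm, weightedMeasure,
    lintegral_withDensity_eq_lintegral_mul_non_measurable _ hμ.measurable.ennreal_ofReal
      (Eventually.of_forall fun _ => ENNReal.ofReal_lt_top), weightedNorm]
  simp only [Pi.mul_apply, mul_comm]

theorem MemWeightedL1.memLp {μ : ℝ × ℝ → ℝ} (hμ : IsWeight μ) {f : ℝ × ℝ → ℂ}
    (hf : MemWeightedL1 μ f) : MemLp f 1 (weightedMeasure μ) :=
  ⟨hf.1.mono_ac (withDensity_absolutelyContinuous _ _), by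
    rw [← weightedNorm_eq_eLpNorm hμ]
    exact hf.2⟩

theorem weightedNorm_le_of_norm_le {μ : ℝ × ℝ → ℝ} (hμ : IsWeight μ) {h : ℝ × ℝ → ℂ} {C : ℝ}
    (hb : ∀ p ∈ unitSquare, ‖h p‖ ≤ C) : weightedNorm μ h ≤ ENNReal.ofReal C := by
  calc weightedNorm μ h ≤ ∫⁻ _p in unitSquare, ENNReal.ofReal C := by
        refine setLIntegral_mono' measurableSet_unitSquare fun p hp => ?_
        refine (mul_le_mul' ?_ (hμ.ofReal_le_one hp)).trans (mul_one _).le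
        rw [← ofReal_norm]
        exact ENNReal.ofReal_le_ofReal (hb p hp)
    _ = ENNReal.ofReal C := by rw [setLIntegral_const, volume_unitSquare, mul_one]

theorem memLp_of_norm_le {μ : ℝ × ℝ → ℝ} (hμ : IsWeight μ) {h : ℝ × ℝ → ℂ}
    (hm : AEStronglyMeasurable h (volume.restrict unitSquare)) {C : ℝ}
    (hb : ∀ p ∈ unitSquare, ‖h p‖ ≤ C) : MemLp h 1 (weightedMeasure μ) :=
  MemWeightedL1.memLp hμ ⟨hm, (weightedNorm_le_of_norm_le hμ hb).trans_lt ENNReal.ofReal_lt_top⟩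

theorem memLp_of_continuousOn {μ : ℝ × ℝ → ℝ} (hμ : IsWeight μ) {g : ℝ × ℝ → ℂ}
    (hg : ContinuousOn g unitSquare) : MemLp g 1 (weightedMeasure μ) := by
  obtain ⟨C, hC⟩ := isCompact_unitSquare.exists_bound_of_continuousOn hg
  exact memLp_of_norm_le hμ (hg.aestronglyMeasurable measurableSet_unitSquare) hC

theorem memLp_walshTerm {a : ℕ} (ha : 2 ≤ a) {μ : ℝ × ℝ → ℝ} (hμ : IsWeight μ)
    (c : ℕ+ × ℕ+ → ℂ) (i : ℕ+ × ℕ+) : MemLp (walshTerm a c i) 1 (weightedMeasure μ) :=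
  memLp_of_norm_le hμ (measurable_walshTerm a c i).aestronglyMeasurable
    fun p _ => (norm_walshTerm ha c i p).le

theorem enorm_toLp_eq_weightedNorm {μ : ℝ × ℝ → ℝ} (hμ : IsWeight μ) {h : ℝ × ℝ → ℂ}
    (hh : MemLp h 1 (weightedMeasure μ)) : ‖hh.toLp h‖ₑ = weightedNorm μ h := by
  rw [Lp.enorm_toLp, weightedNorm_eq_eLpNorm hμ]

theorem exists_memLp_sum_map_eq_toLp {ι : Type*} {ν : Measure (ℝ × ℝ)} {F : ι → ℝ × ℝ → ℂ}
    (hF : ∀ i, MemLp (F i) 1 ν) (L : List ι) :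
    ∃ h : MemLp (fun p => (L.map fun i => F i p).sum) 1 ν,
      (L.map fun i => (hF i).toLp (F i)).sum = h.toLp _ := by
  induction L with
  | nil =>
    exact ⟨MemLp.zero' (ε := ℂ), (MemLp.toLp_zero (E := ℂ) (p := 1) (μ := ν) MemLp.zero).symm⟩
  | cons i L ih =>
    obtain ⟨h, e⟩ := ih
    simp only [List.map_cons, List.sum_cons]
    exact ⟨(hF i).add h, by rw [e]; rfl⟩

theorem norm_le_of_enorm_le_ofReal {X : Type*} [NormedAddCommGroup X] {x : X} {r : ℝ}
    (hr : 0 ≤ r) (h : ‖x‖ₑ ≤ ENNReal.ofReal r) : ‖x‖ ≤ r := by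
  rw [← ofReal_norm] at h
  exact (ENNReal.ofReal_le_ofReal_iff hr).mp h

theorem norm_toLp_le_add {μ : ℝ × ℝ → ℝ} (hμ : IsWeight μ) {h g : ℝ × ℝ → ℂ}
    (hh : MemLp h 1 (weightedMeasure μ)) (hg : MemLp g 1 (weightedMeasure μ)) {r : ℝ}
    (hr : 0 ≤ r) (hle : weightedNorm μ h ≤ weightedNorm μ g + ENNReal.ofReal r) :
    ‖hh.toLp h‖ ≤ ‖hg.toLp g‖ + r := by
  refine norm_le_of_enorm_le_ofReal (by positivity) ?_
  rwa [ENNReal.ofReal_add (norm_nonneg _) hr, ofReal_norm, enorm_toLp_eq_weightedNorm hμ,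
    enorm_toLp_eq_weightedNorm hμ]

theorem frequently_norm_toLp_sub_lt {μ : ℝ × ℝ → ℝ} (hμ : IsWeight μ) {g : ℕ → ℝ × ℝ → ℂ}
    (hg : ∀ m, MemLp (g m) 1 (weightedMeasure μ))
    (hdense : ∀ h : ℝ × ℝ → ℂ, ContinuousOn h unitSquare → ∀ δ > 0,
      ∃ᶠ m in atTop, ∀ p ∈ unitSquare, ‖g m p - h p‖ < δ)
    (v : Lp ℂ 1 (weightedMeasure μ)) {δ : ℝ} (hδ : 0 < δ) :
    ∃ᶠ m in atTop, ‖(hg m).toLp (g m) - v‖ < δ := by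
  have := hμ.isFiniteMeasure
  obtain ⟨h, -, hh1, hh2, hh3⟩ := (Lp.memLp v).exists_hasCompactSupport_eLpNorm_sub_le
    ENNReal.one_ne_top (ε := ENNReal.ofReal (δ / 3)) (by simpa using hδ)
  refine (hdense h hh2.continuousOn (δ / 3) (by positivity)).mono fun m hm => ?_
  have h1 : ‖(hg m).toLp (g m) - hh3.toLp h‖ ≤ δ / 3 := by
    refine norm_le_of_enorm_le_ofReal (by positivity) ?_
    rw [← MemLp.toLp_sub, enorm_toLp_eq_weightedNorm hμ]
    exact weightedNorm_le_of_norm_le hμ fun p hp => (hm p hp).le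
  have h2 : ‖v - hh3.toLp h‖ ≤ δ / 3 := by
    refine norm_le_of_enorm_le_ofReal (by positivity) ?_
    have e : v - hh3.toLp h = ((Lp.memLp v).sub hh3).toLp _ := by
      rw [MemLp.toLp_sub (Lp.memLp v) hh3, Lp.toLp_coeFn v (Lp.memLp v)]
    rw [e, Lp.enorm_toLp]
    exact hh1
  have h3 := norm_sub_le ((hg m).toLp (g m) - hh3.toLp h) (v - hh3.toLp h)
  rw [sub_sub_sub_cancel_right] at h3
  linarith

/-- An integral over the square splits into the part over `E` and a small part where the weight
is small. -/
theorem setLIntegral_unitSquare_le {E : Set (ℝ × ℝ)} (hE : MeasurableSet E)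
    (hEs : E ⊆ unitSquare) {h : ℝ × ℝ → ℝ≥0∞} {δ : ℝ≥0∞}
    (hh : ∀ᵐ p, p ∈ unitSquare \ E → h p ≤ δ) :
    ∫⁻ p in unitSquare, h p ≤ (∫⁻ p in E, h p) + δ := by
  rw [← lintegral_inter_add_sdiff h unitSquare hE, Set.inter_eq_right.mpr hEs]
  gcongr
  calc ∫⁻ p in unitSquare \ E, h p ≤ ∫⁻ _p in unitSquare \ E, δ :=
        setLIntegral_mono_ae' (measurableSet_unitSquare.diff hE) hh
    _ = δ * volume (unitSquare \ E) := setLIntegral_const _ _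
    _ ≤ δ * 1 := mul_le_mul_right
        ((measure_mono Set.sdiff_subset).trans volume_unitSquare.le) δ
    _ = δ := mul_one δ

/-! ### Arranging a sequence in the double array -/

/-- A sequence is placed in the row `ν = 1`, the remaining indices fill the other rows. -/
theorem exists_perm_row {A : Set (ℕ+ × ℕ+)} (hA : Aᶜ.Infinite) (e : ℕ ≃ A) :
    ∃ σ : Equiv.Perm (ℕ+ × ℕ+), (∀ k : ℕ, σ (k.succPNat, 1) = e k) ∧
      ∀ i, i.2 ≠ 1 → σ i ∉ A := by
  classical
  have h1 : Infinite {i // ¬ i ∈ A} := hA.to_subtype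
  have h2 : Infinite {i : ℕ+ × ℕ+ // ¬ i.2 = 1} := by
    refine Infinite.of_injective (fun k : ℕ+ => ⟨(k, 2), (by decide : ¬ (2 : ℕ+) = 1)⟩) fun k k' h => ?_
    simpa using h
  obtain ⟨e₂⟩ : Nonempty ({i : ℕ+ × ℕ+ // ¬ i.2 = 1} ≃ {i // ¬ i ∈ A}) :=
    nonempty_equiv_of_countable
  let e₁ : {i : ℕ+ × ℕ+ // i.2 = 1} ≃ {i // i ∈ A} :=
    { toFun := fun i => e i.1.1.natPred
      invFun := fun i => ⟨((e.symm i).succPNat, 1), rfl⟩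
      left_inv := by
        rintro ⟨⟨k, ν⟩, h⟩
        simp only at h
        simp [h]
      right_inv := fun i => by simp }
  refine ⟨Equiv.subtypeCongr e₁ e₂, fun k => ?_, fun i hi => ?_⟩
  · simp [Equiv.subtypeCongr, Equiv.sumCompl_symm_apply_of_pos, e₁]
  · simpa [Equiv.subtypeCongr, Equiv.sumCompl_symm_apply_of_neg, hi] using
      (e₂ ⟨i, hi⟩).2

theorem sum_eq_sum_range_of_row {M : Type*} [AddCommMonoid M] {Φ : ℕ+ × ℕ+ → M}
    (hΦ : ∀ i, i.2 ≠ 1 → Φ i = 0) {I : Finset (ℕ+ × ℕ+)} {n : ℕ}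
    (hI : ∀ k : ℕ+, (k, 1) ∈ I ↔ (k : ℕ) ≤ n) :
    ∑ i ∈ I, Φ i = ∑ k ∈ Finset.range n, Φ (k.succPNat, 1) := by
  classical
  have hinj : Function.Injective fun k : ℕ => (k.succPNat, (1 : ℕ+)) := fun k k' h =>
    Nat.succPNat_injective (Prod.ext_iff.mp h).1
  rw [← Finset.sum_image (f := Φ) (fun k _ k' _ h => hinj h)]
  symm
  refine Finset.sum_subset (fun i hi => ?_) fun i hi hni => hΦ i fun h1 => hni ?_
  · obtain ⟨k, hk, rfl⟩ := Finset.mem_image.mp hi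
    rw [hI, Nat.succPNat_coe]
    exact Finset.mem_range.mp hk
  · obtain ⟨k, ν⟩ := i
    simp only at h1
    subst h1
    have h2 := (hI k).mp hi
    have h3 := k.natPred_add_one
    exact Finset.mem_image.mpr
      ⟨k.natPred, Finset.mem_range.mpr (by omega), by simp⟩

theorem row_mem_rectIndex (N : ℕ+ × ℕ+) (k : ℕ+) : (k, 1) ∈ rectIndex N ↔ (k : ℕ) ≤ N.1 := by
  simp [rectIndex]

theorem row_mem_diskIndex (R : ℝ) (k : ℕ+) :
    (k, 1) ∈ diskIndex R ↔ (k : ℕ) ≤ ⌊√(R ^ 2 - 1)⌋₊ := by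
  rw [mem_diskIndex, Nat.le_floor_iff (Real.sqrt_nonneg _),
    Real.le_sqrt' (by exact_mod_cast k.pos)]
  simp [le_sub_iff_add_le]

theorem tendsto_floor_sqrt : Tendsto (fun R : ℝ => ⌊√(R ^ 2 - 1)⌋₊) atTop atTop := by
  refine tendsto_nat_floor_atTop.comp (Real.tendsto_sqrt_atTop.comp ?_)
  exact tendsto_atTop_add_const_right _ _ (tendsto_pow_atTop two_ne_zero)

theorem tendsto_fst_pnat : Tendsto (fun N : ℕ+ × ℕ+ => (N.1 : ℕ)) atTop atTop := by
  rw [← prod_atTop_atTop_eq]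
  refine Tendsto.comp (tendsto_atTop.mpr fun n => ?_) tendsto_fst
  filter_upwards [eventually_ge_atTop n.succPNat] with k hk
  exact n.le_succ.trans (PNat.coe_le_coe _ _ |>.mpr hk)

end WalshUniversal

theorem theorem3p2 (a : ℕ) (ha : 2 ≤ a) :
    ∃ c : ℕ+ × ℕ+ → ℂ,
      (∀ q : ℝ, 2 < q → Summable fun i => ‖c i‖ ^ q) ∧
      ∀ ε : ℝ, 0 < ε → ∃ μ : ℝ × ℝ → ℝ,
        WalshUniversal.IsWeight μ ∧
        volume {p | p ∈ WalshUniversal.unitSquare ∧ μ p ≠ 1} < ENNReal.ofReal ε ∧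
        WalshUniversal.IsUniversalRearrangement μ (WalshUniversal.walshTerm a c) := by
  open WalshUniversal in
  obtain ⟨g, hg, hdense⟩ := exists_dense_seq_continuousOn
  obtain ⟨c, L, E, hc1, hcq, hLnd, hL, hEm, hEs, hEv, hclose, hpre⟩ :=
    exists_coefficients ha hg
  refine ⟨c, hcq, fun ε hε => ?_⟩
  have hG : ∀ m, ∃ G : ℝ, ∀ p ∈ unitSquare, ‖g m p‖ ≤ G := fun m =>
    isCompact_unitSquare.exists_bound_of_continuousOn (hg m)
  choose G hG using hG
  obtain ⟨μ, m₀, hμ, hμv, hμS⟩ := exists_weight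
    (fun m => measurableSet_unitSquare.diff (hEm m)) hEv
    (fun m => ∑ i ∈ (L m).toFinset, ‖c i‖ + |G m|) hε
  refine ⟨μ, hμ, hμv, fun f hf => ?_⟩
  have hη0 : ∀ m : ℕ, (0 : ℝ) ≤ (1 / 2) ^ m := fun m => by positivity
  have hF := memLp_walshTerm ha hμ c
  have hgm : ∀ m, MemLp (g m) 1 (weightedMeasure μ) := fun m => memLp_of_continuousOn hμ (hg m)
  -- Off `E m` all functions attached to the block `m` are outweighed.
  have hsmall : ∀ m ≥ m₀, ∀ h : ℝ × ℝ → ℂ,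
      (∀ p ∈ unitSquare, ‖h p‖ ≤ ∑ i ∈ (L m).toFinset, ‖c i‖ + |G m|) →
      weightedNorm μ h
        ≤ (∫⁻ p in E m, ‖h p‖ₑ * ENNReal.ofReal (μ p)) + ENNReal.ofReal ((1 / 2) ^ m) := by
    intro m hm h hh
    refine setLIntegral_unitSquare_le (hEm m) (hEs m) ?_
    filter_upwards [hμS m hm] with p hp hpE
    rw [← ofReal_norm, ← ENNReal.ofReal_mul (norm_nonneg _)]
    refine ENNReal.ofReal_le_ofReal ((mul_le_mul_of_nonneg_right (hh p hpE.1) ?_).trans (hp hpE))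
    exact (hμ.pos p hpE.1).le
  have hpart : ∀ m L', L' <+: L m → ∀ p,
      ‖(L'.map fun i => walshTerm a c i p).sum‖ ≤ ∑ i ∈ (L m).toFinset, ‖c i‖ := by
    intro m L' hL' p
    classical
    rw [← List.sum_toFinset _ (hL'.sublist.nodup (hLnd m))]
    refine (norm_sum_walshTerm_le ha c _ p).trans ?_
    refine Finset.sum_le_sum_of_subset_of_nonneg (fun i hi => ?_) fun i _ _ => norm_nonneg _
    rw [List.mem_toFinset] at hi ⊢
    exact hL'.subset hi
  have hA1 : ({i : ℕ+ × ℕ+ | i.1 ≠ 1}).Infinite := by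
    refine Set.infinite_of_injective_forall_mem (f := fun k : ℕ+ => ((2 : ℕ+), k)) ?_ ?_
    · intro k k' h
      exact (Prod.ext_iff.mp h).2
    · intro k
      simp
  have hA2 : ({i : ℕ+ × ℕ+ | i.1 ≠ 1}ᶜ).Infinite := by
    refine Set.infinite_of_injective_forall_mem (f := fun k : ℕ+ => ((1 : ℕ+), k)) ?_ ?_
    · intro k k' h
      exact (Prod.ext_iff.mp h).2
    · intro k
      simp
  obtain ⟨e, he⟩ : ∃ e : ℕ ≃ {i : ℕ+ × ℕ+ | i.1 ≠ 1}, Tendsto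
      (fun n => ∑ k ∈ Finset.range n, (hF (e k)).toLp (walshTerm a c (e k))) atTop
      (𝓝 ((hf.memLp hμ).toLp f)) := by
    refine exists_enumeration_tendsto
      (F := fun i => (hF i).toLp (walshTerm a c i)) (L := fun m => L (m + m₀))
      (g := fun m => (hgm (m + m₀)).toLp (g (m + m₀)))
      (η := fun m => 2 * (1 / 2) ^ (m + m₀)) ?_ hA1 (fun m => hLnd _)
      (fun m i hi => (hL _ i hi).1) ?_ ?_ ?_ ?_ ?_ _
    · have h3 := (hcq 3 (by norm_num)).tendsto_cofinite_zero
      have h1 : Tendsto (fun i => ‖c i‖) cofinite (𝓝 0) := by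
        have h4 := h3.rpow_const (p := 1 / 3) (Or.inr (by norm_num))
        rw [Real.zero_rpow (by norm_num)] at h4
        refine h4.congr fun i => ?_
        rw [← Real.rpow_mul (norm_nonneg _)]
        norm_num
      refine squeeze_zero (fun _ => norm_nonneg _) (fun i => ?_) h1
      refine norm_le_of_enorm_le_ofReal (norm_nonneg _) ?_
      rw [enorm_toLp_eq_weightedNorm hμ]
      exact weightedNorm_le_of_norm_le hμ fun p _ => (norm_walshTerm ha c i p).le
    · intro U
      classical
      filter_upwards [eventually_gt_atTop (U.toFinset.sup fun i => (i.1 : ℕ))] with m hm i hi hiU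
      have h1 := Finset.le_sup (f := fun i : ℕ+ × ℕ+ => (i.1 : ℕ)) (List.mem_toFinset.mpr hiU)
      have h2 := (hL _ i hi).2
      omega
    · have h1 : Tendsto (fun m : ℕ => 2 * (1 / 2 : ℝ) ^ m) atTop (𝓝 0) := by
        simpa using (tendsto_pow_atTop_nhds_zero_of_lt_one (r := (1 / 2 : ℝ)) (by norm_num)
          (by norm_num)).const_mul (2 : ℝ)
      exact h1.comp (tendsto_add_atTop_nat m₀)
    · intro m L' hL'
      obtain ⟨hs, e1⟩ := exists_memLp_sum_map_eq_toLp hF L'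
      rw [e1]
      refine norm_toLp_le_add hμ hs (hgm _) (by positivity) ?_
      refine (hsmall (m + m₀) (by omega) _ fun p _ =>
        (hpart _ L' hL' p).trans (le_add_of_nonneg_right (abs_nonneg _))).trans ?_
      refine (add_le_add_left (hpre _ L' hL' (fun p => ENNReal.ofReal (μ p))
        fun p hp => hμ.ofReal_le_one hp) _).trans ?_
      rw [add_assoc, ← ENNReal.ofReal_add (hη0 _) (hη0 _), ← two_mul]
      gcongr
      exact lintegral_mono_set (hEs _)
    · intro m
      obtain ⟨hs, e1⟩ := exists_memLp_sum_map_eq_toLp hF (L (m + m₀))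
      rw [e1, ← MemLp.toLp_sub]
      refine norm_le_of_enorm_le_ofReal (by positivity) ?_
      rw [enorm_toLp_eq_weightedNorm hμ]
      refine (hsmall (m + m₀) (by omega) _ fun p hp => (norm_sub_le _ _).trans
        (add_le_add (hpart _ _ List.prefix_rfl p) ((hG _ p hp).trans (le_abs_self _)))).trans ?_
      rw [two_mul, ENNReal.ofReal_add (hη0 _) (hη0 _)]
      gcongr
      calc ∫⁻ p in E (m + m₀), ‖((L (m + m₀)).map fun i => walshTerm a c i p).sum
            - g (m + m₀) p‖ₑ * ENNReal.ofReal (μ p)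
          ≤ ∫⁻ _p in E (m + m₀), ENNReal.ofReal ((1 / 2) ^ (m + m₀)) := by
            refine setLIntegral_mono' (hEm _) fun p hp => ?_
            refine (mul_le_mul' ?_ (hμ.ofReal_le_one (hEs _ hp))).trans (mul_one _).le
            rw [← ofReal_norm]
            exact ENNReal.ofReal_le_ofReal (hclose _ p hp)
        _ ≤ ENNReal.ofReal ((1 / 2) ^ (m + m₀)) := by
            rw [setLIntegral_const]
            exact (mul_le_mul_right ((measure_mono (hEs _)).trans volume_unitSquare.le) _).trans
              (mul_one _).le
    · intro v δ hδ
      have h1 := frequently_norm_toLp_sub_lt hμ hgm hdense v hδ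
      rw [frequently_atTop] at h1 ⊢
      intro n
      obtain ⟨m, hm, h2⟩ := h1 (n + m₀)
      refine ⟨m - m₀, by omega, ?_⟩
      have h3 : m - m₀ + m₀ = m := by omega
      rw [h3]
      exact h2
  obtain ⟨σ, hσ1, hσ2⟩ := exists_perm_row hA2 e
  have hlim : Tendsto (fun n : ℕ => weightedNorm μ fun p =>
      (∑ k ∈ Finset.range n, walshTerm a c (e k) p) - f p) atTop (𝓝 0) := by
    have h1 := (tendsto_iff_enorm_sub_tendsto_zero).mp he
    refine h1.congr fun n => ?_
    obtain ⟨hs, e1⟩ := exists_memLp_sum_map_eq_toLp (fun k : ℕ => hF (e k)) (List.range n)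
    have e2 : ∀ {M : Type} [AddCommMonoid M] (Φ : ℕ → M),
        ∑ k ∈ Finset.range n, Φ k = ((List.range n).map Φ).sum := fun Φ => by
      rw [← List.toFinset_range, List.sum_toFinset _ List.nodup_range]
    simp only [e2]
    rw [e1, ← MemLp.toLp_sub, enorm_toLp_eq_weightedNorm hμ]
    rfl
  have hrow : ∀ (I : Finset (ℕ+ × ℕ+)) (n : ℕ), (∀ k : ℕ+, (k, 1) ∈ I ↔ (k : ℕ) ≤ n) →
      (fun p => (∑ i ∈ I, walshTerm a c (σ i) p) - f p)
        = fun p => (∑ k ∈ Finset.range n, walshTerm a c (e k) p) - f p := by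
    intro I n hI
    funext p
    rw [sum_eq_sum_range_of_row (Φ := fun i => walshTerm a c (σ i) p) ?_ hI]
    · simp only [hσ1]
    · intro i hi
      have : (σ i).1 = 1 := by simpa using hσ2 i hi
      simp [walshTerm, hc1 _ this]
  refine ⟨σ, ?_, ?_⟩
  · refine (hlim.comp tendsto_fst_pnat).congr fun N => ?_
    simp only [Function.comp_apply]
    rw [hrow _ _ (row_mem_rectIndex N)]
  · refine (hlim.comp tendsto_floor_sqrt).congr fun R => ?_
    simp only [Function.comp_apply]
    rw [hrow _ _ (row_mem_diskIndex R)]
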